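/- **Model.** A dynamic set stream over $[n]$ is a finite sequence $F=\langle (S_1,\Delta_1),\dots,(S_t,\Delta_t)\rangle$ with $S_i\subseteq[n]$ and $\Delta_i\in\{-1,+1\}$ (insertion or deletion of one copy of $S_i$) such that the multiplicity $\sum_{i\le j,\,S_i=S}\Delta_i$ of every set $S\subseteq[n]$ is non-negative at every time $j\le t$. Its final set system $\mathcal S_F$ consists of the sets whose multiplicity at the end of the stream is positive. The stream is feasible if $\bigcup \mathcal S_F=[n]$. A set cover is a subcollection of $\mathcal S_F$ whose union is $[n]$; it is an $\alpha$-approximation if it has at most $\alpha\cdot\mathrm{opt}$ sets, where $\mathrm{opt}$ is the smallest size of a set cover. A randomized streaming algorithm with $s$ bits of space and $p$ passes reads the stream $p$ times, in order. Its memory consists of $s$ bits, with a random initial content; at every update, and at the end of every pass, the memory content is replaced by a random one whose distribution depends only on the current content and (at an update) on the update read. The content after the last pass determines, for every set $S\subseteq[n]$, whether $S$ is chosen; the algorithm returns the chosen sets of $\mathcal S_F$. (Local computation between updates is not restricted, and the algorithm may depend on $n$ and $m$.) **Theorem.** There is a randomized semi-streaming algorithm that, with high probability, computes an $O(\log n)$-approximate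 set cover in dynamic set streams in $O(\log m\cdot\log n)$ passes, where $m$ bounds the number of sets in the final set system. Precisely, there are constants $C$ and $e$ such that for all natural numbers $c,d$ there is a constant $K$ such that for all integers $n,m\ge 2$ there is a randomized streaming algorithm for streams over $[n]$ with at most $K\,n\,(\log m+\log n)^e$ bits of space and at most $C\log m\cdot\log n$ passes, with the following property. Let $F$ be any feasible dynamic set stream (of any length) such that $|\mathcal S_F|\le m$ and such that every set has multiplicity at most $(nm)^d$ at the end of the stream. Then, with probability at least $1-(nm)^{-c}$, the collection returned on $F$ is a $(C\log n)$-approximate set cover of $\mathcal S_F$ and, in case $F$ has length at most $(nm)^d$, no set that occurs in $F$ but is absent from $\mathcal S_F$ is chosen. -/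

import Mathlib

/-- One update of a dynamic set stream over the universe `Fin n`: a set together with a sign, where
`1 : ℤˣ` inserts one copy of the set and `-1 : ℤˣ` deletes one copy. -/
abbrev SetUpdate (n : ℕ) : Type := Finset (Fin n) × ℤˣ

/-- The multiplicity of the set `S` after the updates `F`: the sum of the signs of the updates of `S`. -/
def setMultiplicity {n : ℕ} (F : List (SetUpdate n)) (S : Finset (Fin n)) : ℤ :=
  ((F.filter (fun a => a.1 = S)).map (fun a => (a.2 : ℤ))).sum

/-- A list of updates is a dynamic set stream if no multiplicity is negative at any time. -/
def IsDynamicSetStream {n : ℕ} (F : List (SetUpdate n)) : Prop :=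
  ∀ G : List (SetUpdate n), G <+: F → ∀ S : Finset (Fin n), 0 ≤ setMultiplicity G S

/-- The set system defined by a stream: the sets that are present at its end. -/
def finalSets {n : ℕ} (F : List (SetUpdate n)) : Finset (Finset (Fin n)) :=
  Finset.univ.filter (fun S => 0 < setMultiplicity F S)

/-- `𝒞` is a set cover for the instance `𝒮`: a subcollection of `𝒮` covering the whole universe. -/
def IsSetCover {n : ℕ} (𝒮 𝒞 : Finset (Finset (Fin n))) : Prop :=
  𝒞 ⊆ 𝒮 ∧ ∀ x : Fin n, ∃ S ∈ 𝒞, x ∈ S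

/-- `𝒞` is an `α`-approximate set cover for `𝒮`: a set cover with at most `α` times as many sets as
any other set cover (equivalently, as a smallest one). -/
def IsApproxSetCover {n : ℕ} (α : ℝ) (𝒮 𝒞 : Finset (Finset (Fin n))) : Prop :=
  IsSetCover 𝒮 𝒞 ∧ ∀ 𝒟, IsSetCover 𝒮 𝒟 → (𝒞.card : ℝ) ≤ α * (𝒟.card : ℝ)

/-- A randomized multi-pass streaming algorithm on streams of updates of subsets of `Fin n`, whose
output is a subcollection of the sets of the stream. Its only storage are `space` bits of memory; all
that it keeps of earlier updates, passes and coin tosses has to be in these bits. -/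
structure StreamingAlgorithm (n : ℕ) where
  /-- the number of bits of memory -/
  space : ℕ
  /-- the number of passes over the stream -/
  passes : ℕ
  /-- the (random) initial content of the memory -/
  init : PMF (Fin space → Bool)
  /-- the (random) change of the memory when an update is read -/
  step : (Fin space → Bool) → SetUpdate n → PMF (Fin space → Bool)
  /-- the (random) change of the memory when the end of the stream is reached -/
  endPass : (Fin space → Bool) → PMF (Fin space → Bool)
  /-- the output: which sets are chosen, as described by the final content of the memory -/
  select : (Fin space → Bool) → Finset (Fin n) → Bool

namespace StreamingAlgorithm

variable {n : ℕ} (A : StreamingAlgorithm n)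

/-- The distribution of the memory after reading a list of updates, from a given memory content. -/
noncomputable def read : List (SetUpdate n) → (Fin A.space → Bool) → PMF (Fin A.space → Bool)
  | [], s => PMF.pure s
  | a :: F, s => (A.step s a).bind (fun t => read F t)

/-- The distribution of the memory after the first `p` passes over the stream `F`. -/
noncomputable def afterPasses (F : List (SetUpdate n)) : ℕ → PMF (Fin A.space → Bool)
  | 0 => A.init
  | p + 1 => (afterPasses F p).bind (fun s => (A.read F s).bind A.endPass)

/-- The distribution of the memory at the end of the computation on the stream `F`. -/
noncomputable def run (F : List (SetUpdate n)) : PMF (Fin A.space → Bool) :=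
  A.afterPasses F A.passes

/-- The collection of sets returned on the stream `F` when the final memory content is `s`: those
sets of the final set system that are chosen. -/
def solution (F : List (SetUpdate n)) (s : Fin A.space → Bool) : Finset (Finset (Fin n)) :=
  (finalSets F).filter (fun S => A.select s S = true)

/-- No set is chosen that occurs in the stream but is absent at its end, so that a chosen set can be
reported as soon as it is seen in the stream. -/
def ChoosesNoDeletedSet (F : List (SetUpdate n)) (s : Fin A.space → Bool) : Prop :=
  ∀ a ∈ F, A.select s a.1 = true → a.1 ∈ finalSets F

end StreamingAlgorithm

/-! Greedy set cover is relaxed to `O(log n)` phases with thresholds `t` halving down to `1`. A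
phase has `O(log m)` rounds; in each, every set with at least `t` uncovered elements is picked with
probability `p`, where `p` doubles from at most `1 / m` to `1`. The final round of a phase leaves no
set with `t` uncovered elements, so throughout the next phase no set has more than twice the
threshold.

The cost is controlled by a potential (`expect_round_le`). Let `𝒟` be an optimal cover and `a x` the
expected number of sampled eligible sets containing `x`. Each picked set is charged to its at least
`t` uncovered elements, so `x` pays `a x / t` in expectation. Pairwise independence and a second
moment bound show that `x` gets covered with probability at least `a / (1 + a)`; a covered element
lowers `8 * ∑ S ∈ 𝒟, harmonic #(S ∩ U)` by at least `4 / t`. Adding `(1 / t) * ∑ a (a - 1) / (a +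
1)` makes the picks so far plus the potential a supermartingale: doubling `p` is paid for, and at
the start of a phase `a ≤ 1` makes the extra term nonpositive. The expected cover size is therefore
`O(log n) * #𝒟`.

The seeds and the uncovered elements of each round determine which sets are picked, so the cover is
never stored. The next uncovered set is read off `n` counters, linear in the multiplicities and
hence indifferent to deletions; a modulus above the total multiplicity makes their zero test exact.

High probability comes from independent copies (`card_not_goodChoices_le`). Their covers are
compared through the numbers of nonzero buckets in small hash tables, and the same tables reject
deleted sets: a chosen set must hit a nonzero bucket in every table
(`CoverSketch.output_iterate_of_goodChoices`). -/

open Finset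
open scoped BigOperators

/-! ### Linear sketches as streaming algorithms -/

/-- The sum over a stream of `Δ • w S` only depends on the multiplicities of the sets. -/
theorem sum_map_zsmul_eq_sum_setMultiplicity {n : ℕ} {V : Type*} [AddCommGroup V]
    (F : List (SetUpdate n)) (w : Finset (Fin n) → V) :
    (F.map fun a => (a.2 : ℤ) • w a.1).sum = ∑ S, setMultiplicity F S • w S := by
  induction F with
  | nil => simp [setMultiplicity]
  | cons a F ih =>
    have h : ∀ S, setMultiplicity (a :: F) S =
        (if a.1 = S then (a.2 : ℤ) else 0) + setMultiplicity F S := by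
      intro S
      by_cases hS : a.1 = S <;> simp [setMultiplicity, hS]
    simp [h, ih, add_smul, sum_add_distrib, ite_smul]

/-- A multi-pass linear sketch: each pass computes a vector that is linear in the multiplicities,
using what is known from earlier passes, and then the knowledge is updated by `g`. -/
theorem exists_streamingAlgorithm_of_linearSketch {n : ℕ} {Ω K V : Type} [Fintype Ω] [Nonempty Ω]
    [Fintype K] [Fintype V] [AddCommGroup V] (s p : ℕ)
    (hcard : Fintype.card K * Fintype.card V ≤ 2 ^ s)
    (start : Ω → K) (w : K → Finset (Fin n) → V) (g : K → V → K) (out : K → Finset (Fin n) → Bool) :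
    ∃ A : StreamingAlgorithm n, A.space = s ∧ A.passes = p ∧
      ∀ (F : List (SetUpdate n)) (P : (Finset (Fin n) → Bool) → Prop),
        (PMF.uniformOfFintype Ω).toOuterMeasure {ω | P (out
          ((fun k => g k (∑ S, setMultiplicity F S • w k S))^[p] (start ω)))} ≤
        (A.run F).toOuterMeasure {σ | P (A.select σ)} := by
  classical
  obtain ⟨enc⟩ : Nonempty (K × V ↪ (Fin s → Bool)) := by
    apply Function.Embedding.nonempty_of_card_le
    simpa using hcard
  have : Nonempty (K × V) := ⟨(start (Classical.arbitrary Ω), 0)⟩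
  -- Codes outside the range of `enc` decode arbitrarily; no run reaches them. All randomness is
  -- drawn in `init`, and the running vector is reset to `0` at the end of each pass.
  set dec : (Fin s → Bool) → K × V := Function.invFun enc with hdec
  have hde : ∀ x, dec (enc x) = x := Function.leftInverse_invFun enc.injective
  let A : StreamingAlgorithm n :=
    { space := s
      passes := p
      init := (PMF.uniformOfFintype Ω).map (fun ω => enc (start ω, 0))
      step := fun σ a => PMF.pure (enc ((dec σ).1, (dec σ).2 + (a.2 : ℤ) • w (dec σ).1 a.1))
      endPass := fun σ => PMF.pure (enc (g (dec σ).1 (dec σ).2, 0))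
      select := fun σ => out (dec σ).1 }
  refine ⟨A, rfl, rfl, fun F P => ?_⟩
  have hread : ∀ (F : List (SetUpdate n)) (k : K) (v : V), A.read F (enc (k, v)) =
      PMF.pure (enc (k, v + (F.map fun a => (a.2 : ℤ) • w k a.1).sum)) := by
    intro F
    induction F with
    | nil => intro k v; simp [StreamingAlgorithm.read]
    | cons a F ih =>
      intro k v
      have : A.step (enc (k, v)) a = PMF.pure (enc (k, v + (a.2 : ℤ) • w k a.1)) := by
        simp only [A, hde]
      rw [StreamingAlgorithm.read, this, PMF.pure_bind, ih]
      simp [add_assoc]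
  have hpass : ∀ q, A.afterPasses F q = (PMF.uniformOfFintype Ω).map (fun ω =>
      enc ((fun k => g k (∑ S, setMultiplicity F S • w k S))^[q] (start ω), 0)) := by
    intro q
    induction q with
    | zero => rfl
    | succ q ih =>
      rw [StreamingAlgorithm.afterPasses, ih, PMF.bind_map, PMF.map]
      congr 1
      funext ω
      simp only [Function.comp_apply]
      rw [hread, PMF.pure_bind, sum_map_zsmul_eq_sum_setMultiplicity, zero_add,
        Function.iterate_succ_apply']
      simp only [A, hde]
  rw [StreamingAlgorithm.run, hpass, PMF.toOuterMeasure_map_apply]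
  apply MeasureTheory.OuterMeasure.mono
  intro ω hω
  simpa [A, hde] using hω

/-! ### Pairwise independent linear hashing -/

/-- The fibres of a surjective homomorphism of finite groups have the same size. -/
theorem card_filter_mem_mul_card_of_surjective {G K : Type*} [AddGroup G] [AddGroup K] [Fintype G]
    [Fintype K] [DecidableEq K] (f : G →+ K) (hf : Function.Surjective f) (X : Finset K) :
    #{g | f g ∈ X} * Fintype.card K = #X * Fintype.card G := by
  have h : ∀ k, #{g | f g = k} = #{g | f g = 0} := fun k =>
    AddMonoidHom.card_fiber_eq_of_mem_range f (hf k) (hf 0)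
  have hG : Fintype.card G = Fintype.card K * #{g | f g = 0} := by
    rw [← card_univ, card_eq_sum_card_fiberwise (f := f) (t := univ) (by simp)]
    simp [h]
  have hX : #{g | f g ∈ X} = #X * #{g | f g = 0} := by
    rw [card_eq_sum_card_fiberwise (f := f) (t := X) (by intro x; simp)]
    rw [← smul_eq_mul, ← sum_const]
    refine sum_congr rfl fun k hk => ?_
    rw [← h k, filter_filter]
    congr 1
    ext g
    simp only [mem_filter, mem_univ, true_and]
    constructor
    · exact fun h => h.2
    · rintro rfl; exact ⟨hk, rfl⟩
  rw [hX, hG]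
  ring

/-- Seeds of the linear hash functions from subsets of `α` to `ZMod N`. -/
abbrev HashSeed (α : Type*) (N : ℕ) : Type _ := Option α → ZMod N

section LinearHash

variable {α : Type*} {N : ℕ}

/-- The linear hash function with a given seed. -/
def linearHash (h : HashSeed α N) (S : Finset α) : ZMod N := h none + ∑ x ∈ S, h (some x)

/-- The hash value as a homomorphism in the seed. -/
def linearHashHom (N : ℕ) (S : Finset α) : HashSeed α N →+ ZMod N where
  toFun h := linearHash h S
  map_zero' := by simp [linearHash]
  map_add' a b := by simp [linearHash, sum_add_distrib]; ring

theorem linearHashHom_surjective (S : Finset α) : Function.Surjective (linearHashHom N S) := by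
  intro a
  refine ⟨fun o => if o = none then a else 0, ?_⟩
  simp [linearHashHom, linearHash]

variable [DecidableEq α]

/-- An element `x` lying in just one of the two sets decouples the values: the constant term fixes
the value on the set without `x`, and the coefficient at `x` corrects the other. Equal fibres then
make the two hash values independent and uniform. -/
theorem linearHashHom_prod_surjective {S T : Finset α} (hST : S ≠ T) :
    Function.Surjective ((linearHashHom N S).prod (linearHashHom N T)) := by
  rintro ⟨a, b⟩
  have key : ∀ {S T : Finset α} (a b : ZMod N) (x : α), x ∈ S → x ∉ T →
      ∃ h : HashSeed α N, linearHash h S = a ∧ linearHash h T = b := by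
    intro S T a b x hS hT
    refine ⟨fun o => if o = none then b else if o = some x then a - b else 0, ?_, ?_⟩
    · simp [linearHash, hS]
    · simp [linearHash, hT]
  by_cases h : S ⊆ T
  · obtain ⟨x, hxT, hxS⟩ : ∃ x ∈ T, x ∉ S :=
      not_subset.1 fun h' => hST (Subset.antisymm h h')
    obtain ⟨h, h1, h2⟩ := key b a x hxT hxS
    exact ⟨h, Prod.ext h2 h1⟩
  · obtain ⟨x, hxS, hxT⟩ := not_subset.1 h
    obtain ⟨h, h1, h2⟩ := key a b x hxS hxT
    exact ⟨h, Prod.ext h1 h2⟩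

variable [Fintype α] [NeZero N]

theorem card_linearHash_mem (S : Finset α) (X : Finset (ZMod N)) :
    #{h : HashSeed α N | linearHash h S ∈ X} * N = #X * Fintype.card (HashSeed α N) := by
  have := card_filter_mem_mul_card_of_surjective (linearHashHom N S) (linearHashHom_surjective S) X
  rwa [ZMod.card] at this

theorem card_linearHash_pair_mem {S T : Finset α} (hST : S ≠ T) (X : Finset (ZMod N × ZMod N)) :
    #{h : HashSeed α N | (linearHash h S, linearHash h T) ∈ X} * (N * N) =
      #X * Fintype.card (HashSeed α N) := by
  have := card_filter_mem_mul_card_of_surjective _ (linearHashHom_prod_surjective (N := N) hST) X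
  rwa [Fintype.card_prod, ZMod.card] at this

theorem card_linearHash_collision {S T : Finset α} (hST : S ≠ T) :
    #{h : HashSeed α N | linearHash h S = linearHash h T} * N = Fintype.card (HashSeed α N) := by
  have h := card_linearHash_pair_mem hST (univ.image fun a : ZMod N => (a, a))
  rw [card_image_of_injective _ (fun a b h => (Prod.ext_iff.1 h).1), card_univ, ZMod.card] at h
  have hN : 0 < N := NeZero.pos N
  apply Nat.eq_of_mul_eq_mul_left hN
  rw [← h]
  simp only [mem_image, mem_univ, true_and, Prod.mk.injEq]
  have : ∀ h : HashSeed α N, (∃ a, a = linearHash h S ∧ a = linearHash h T) ↔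
      linearHash h S = linearHash h T := fun h => by simp
  simp only [this]
  ring

end LinearHash

/-! ### Pairwise independent sampling and the second moment -/

/-- A random subfamily `{S | z h S}` that contains every set with probability `p`, pairwise
independently. -/
def IsPairwiseSampling {α H : Type*} [Fintype H] (p : ℝ) (z : H → Finset α → Bool) : Prop :=
  (∀ S, 𝔼 h, (if z h S then (1 : ℝ) else 0) = p) ∧
    ∀ S T, S ≠ T → 𝔼 h, (if z h S then (1 : ℝ) else 0) * (if z h T then (1 : ℝ) else 0) = p * p

/-- A pairwise independent sample of a family is nonempty with probability at least `a / (1 + a)`,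
where `a` is the expected size of the sample. -/
theorem IsPairwiseSampling.le_expect_exists {α H : Type*} [Fintype H] {p : ℝ}
    {z : H → Finset α → Bool} (hz : IsPairwiseSampling p z) (hp : 0 ≤ p) (D : Finset (Finset α)) :
    p * #D / (1 + p * #D) ≤ 𝔼 h, (if ∃ S ∈ D, z h S then (1 : ℝ) else 0) := by
  classical
  set a : ℝ := p * #D with ha
  have ha0 : 0 ≤ a := by positivity
  set X : H → ℝ := fun h => ∑ S ∈ D, (if z h S then (1 : ℝ) else 0) with hX
  have hX1 : 𝔼 h, X h = a := by
    simp only [hX]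
    rw [expect_sum_comm, sum_congr rfl fun S _ => hz.1 S]
    simp [ha, mul_comm]
  have hX2 : 𝔼 h, X h * X h ≤ a + a * a := by
    simp only [hX, sum_mul_sum]
    rw [expect_sum_comm]
    have : ∀ S ∈ D, 𝔼 h, ∑ T ∈ D, (if z h S then (1 : ℝ) else 0) * (if z h T then (1 : ℝ) else 0)
        ≤ p + p * a := by
      intro S hS
      rw [expect_sum_comm]
      have : ∀ T ∈ D, 𝔼 h, (if z h S then (1 : ℝ) else 0) * (if z h T then (1 : ℝ) else 0) ≤
          (if S = T then p else 0) + p * p := by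
        intro T _
        by_cases hST : S = T
        · subst hST
          have : ∀ h, (if z h S then (1 : ℝ) else 0) * (if z h S then (1 : ℝ) else 0) =
            if z h S then (1 : ℝ) else 0 := by intro h; split_ifs <;> simp
          simp only [this, hz.1 S, if_true]
          nlinarith [mul_nonneg hp hp]
        · rw [hz.2 S T hST]; simp [hST]
      refine (sum_le_sum this).trans ?_
      rw [sum_add_distrib, sum_ite_eq, if_pos hS, sum_const, nsmul_eq_mul, ha]
      apply le_of_eq; ring
    refine (sum_le_sum this).trans ?_
    rw [sum_const, nsmul_eq_mul, ha]
    apply le_of_eq; ring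
  -- The indicator of `X ≠ 0` is at least `1 - (1 - l * X) ^ 2` for every `l`; this `l` maximizes
  -- the resulting bound `2 * l * a - l ^ 2 * (a + a ^ 2)`.
  set l : ℝ := 1 / (1 + a) with hl
  have hpt : ∀ h, 2 * l * X h - l * l * (X h * X h) ≤
      if ∃ S ∈ D, z h S then (1 : ℝ) else 0 := by
    intro h
    split_ifs with hex
    · nlinarith [sq_nonneg (1 - l * X h)]
    · have : X h = 0 := sum_eq_zero fun S hS => if_neg fun hzS => hex ⟨S, hS, hzS⟩
      simp [this]
  have hE : 𝔼 h, (2 * l * X h - l * l * (X h * X h)) ≤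
      𝔼 h, (if ∃ S ∈ D, z h S then (1 : ℝ) else 0) := expect_le_expect fun h _ => hpt h
  rw [expect_sub_distrib, ← mul_expect, ← mul_expect, hX1] at hE
  refine le_trans ?_ hE
  have h1 : l * l * 𝔼 h, X h * X h ≤ l * l * (a + a * a) :=
    mul_le_mul_of_nonneg_left hX2 (mul_self_nonneg l)
  have h2 : a / (1 + a) = 2 * l * a - l * l * (a + a * a) := by
    rw [hl]; field_simp; ring
  linarith

/-! ### The potential in one sampling round -/

theorem sub_div_le_harmonic_sub {s t u : ℕ} (hst : s ≤ t) (htu : t ≤ u) :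
    ((t : ℝ) - s) / u ≤ (harmonic t : ℝ) - harmonic s := by
  induction t, hst using Nat.le_induction with
  | base => simp
  | succ t hst ih =>
    have := ih (by omega)
    rw [harmonic_succ]
    push_cast at *
    have hle : 1 / (u : ℝ) ≤ ((t : ℝ) + 1)⁻¹ := by
      rw [one_div]
      apply inv_anti₀ (by positivity)
      exact_mod_cast htu
    have : ((t : ℝ) + 1 - s) / u = ((t : ℝ) - s) / u + 1 / u := by ring
    linarith

section Round

variable {α : Type*} [DecidableEq α]

/-- The sets of the system that have at least `t` elements in `U`. -/
def eligibleSets (𝒮 : Finset (Finset α)) (t : ℕ) (U : Finset α) : Finset (Finset α) :=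
  {S ∈ 𝒮 | t ≤ #(S ∩ U)}

/-- The sampled eligible sets. -/
def pickedSets (𝒮 : Finset (Finset α)) (t : ℕ) (y : Finset α → Bool) (U : Finset α) :
    Finset (Finset α) :=
  {S ∈ eligibleSets 𝒮 t U | y S}

/-- The elements of `U` that are not covered by the sampled eligible sets. -/
def leftover (𝒮 : Finset (Finset α)) (t : ℕ) (y : Finset α → Bool) (U : Finset α) : Finset α :=
  {x ∈ U | ∀ S ∈ pickedSets 𝒮 t y U, x ∉ S}

/-- The expected number of sampled eligible sets that contain `x`. -/
noncomputable def expectedDegree (𝒮 : Finset (Finset α)) (t : ℕ) (p : ℝ) (U : Finset α) (x : α) :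
    ℝ :=
  p * #{S ∈ eligibleSets 𝒮 t U | x ∈ S}

/-- The part of the potential that pays for covering elements. -/
noncomputable def harmonicPotential (𝒟 : Finset (Finset α)) (U : Finset α) : ℝ :=
  8 * ∑ S ∈ 𝒟, (harmonic #(S ∩ U) : ℝ)

/-- The potential function of the sampling process. -/
noncomputable def roundPotential (𝒮 𝒟 : Finset (Finset α)) (t : ℕ) (p : ℝ) (U : Finset α) : ℝ :=
  harmonicPotential 𝒟 U + (1 / t) * ∑ x ∈ U, expectedDegree 𝒮 t p U x *
    (expectedDegree 𝒮 t p U x - 1) / (expectedDegree 𝒮 t p U x + 1)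

theorem leftover_subset (𝒮 : Finset (Finset α)) (t : ℕ) (y : Finset α → Bool) (U : Finset α) :
    leftover 𝒮 t y U ⊆ U := filter_subset _ _

theorem expectedDegree_nonneg {p : ℝ} (hp : 0 ≤ p) (𝒮 : Finset (Finset α)) (t : ℕ) (U : Finset α)
    (x : α) : 0 ≤ expectedDegree 𝒮 t p U x := by
  unfold expectedDegree; positivity

theorem eligibleSets_mono {𝒮 : Finset (Finset α)} {t : ℕ} {U U' : Finset α} (h : U' ⊆ U) :
    eligibleSets 𝒮 t U' ⊆ eligibleSets 𝒮 t U := by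
  intro S
  simp only [eligibleSets, mem_filter]
  exact fun hS => ⟨hS.1, hS.2.trans (card_le_card (inter_subset_inter_left h))⟩

/-- Double counting of incidences: every picked set meets `U` in at least `t` elements. -/
theorem card_pickedSets_le {𝒮 : Finset (Finset α)} {t : ℕ} (ht : 0 < t) (y : Finset α → Bool)
    (U : Finset α) :
    (#(pickedSets 𝒮 t y U) : ℝ) ≤
      (1 / t) * ∑ x ∈ U, (#{S ∈ pickedSets 𝒮 t y U | x ∈ S} : ℝ) := by
  have h1 : ∑ x ∈ U, #{S ∈ pickedSets 𝒮 t y U | x ∈ S} =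
      ∑ S ∈ pickedSets 𝒮 t y U, #(S ∩ U) := by
    have := sum_card_bipartiteAbove_eq_sum_card_bipartiteBelow (s := U)
      (t := pickedSets 𝒮 t y U) (fun x S => x ∈ S)
    simp only [bipartiteAbove, bipartiteBelow] at this
    rw [this]
    refine sum_congr rfl fun S _ => ?_
    rw [inter_comm, ← filter_mem_eq_inter]
  have h2 : #(pickedSets 𝒮 t y U) * t ≤ ∑ S ∈ pickedSets 𝒮 t y U, #(S ∩ U) := by
    rw [← smul_eq_mul]
    apply card_nsmul_le_sum
    intro S hS
    simp only [pickedSets, eligibleSets, mem_filter] at hS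
    exact hS.1.2
  rw [← h1] at h2
  have h3 : (#(pickedSets 𝒮 t y U) : ℝ) * t ≤
      ∑ x ∈ U, (#{S ∈ pickedSets 𝒮 t y U | x ∈ S} : ℝ) := by exact_mod_cast h2
  rw [one_div, inv_mul_eq_div, le_div_iff₀ (by exact_mod_cast ht)]
  exact h3

/-- Each removed element lies in some `S ∈ 𝒟`. As `#(S ∩ U) ≤ 2 * t`, every harmonic term lost is at
least `1 / (2 * t)`; the factor `8` turns this into `4 / t` per element. -/
theorem harmonicPotential_add_le {𝒟 : Finset (Finset α)} {t : ℕ} (ht : 0 < t) {U U' : Finset α}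
    (hU : U' ⊆ U) (hcov : ∀ x ∈ U, ∃ S ∈ 𝒟, x ∈ S) (hsmall : ∀ S ∈ 𝒟, #(S ∩ U) ≤ 2 * t) :
    harmonicPotential 𝒟 U' + 4 * ((1 / t) * #(U \ U')) ≤ harmonicPotential 𝒟 U := by
  have ht' : (0 : ℝ) < t := by exact_mod_cast ht
  have h1 : #(U \ U') ≤ ∑ S ∈ 𝒟, #(S ∩ (U \ U')) := by
    refine (card_le_card ?_).trans card_biUnion_le
    intro x hx
    obtain ⟨S, hS, hxS⟩ := hcov x (mem_sdiff.1 hx).1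
    exact mem_biUnion.2 ⟨S, hS, mem_inter.2 ⟨hxS, hx⟩⟩
  have h2 : ∀ S ∈ 𝒟, (#(S ∩ (U \ U')) : ℝ) / (2 * t) ≤
      (harmonic #(S ∩ U) : ℝ) - harmonic #(S ∩ U') := by
    intro S hS
    have hsub : S ∩ U' ⊆ S ∩ U := inter_subset_inter_left hU
    have := sub_div_le_harmonic_sub (card_le_card hsub) (hsmall S hS)
    have hc : #(S ∩ (U \ U')) + #(S ∩ U') = #(S ∩ U) := by
      rw [← card_sdiff_add_card_eq_card hsub]
      congr 2
      ext x
      simp only [mem_inter, mem_sdiff]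
      tauto
    have hc' : (#(S ∩ U) : ℝ) - #(S ∩ U') = #(S ∩ (U \ U')) := by
      rw [← hc]; push_cast; ring
    rw [hc'] at this
    push_cast at this
    exact this
  have h3 := sum_le_sum h2
  rw [← sum_div, sum_sub_distrib] at h3
  have h4 : (#(U \ U') : ℝ) ≤ ∑ S ∈ 𝒟, (#(S ∩ (U \ U')) : ℝ) := by exact_mod_cast h1
  have h5 : (#(U \ U') : ℝ) / (2 * t) ≤ (∑ S ∈ 𝒟, (#(S ∩ (U \ U')) : ℝ)) / (2 * t) := by gcongr
  have h6 : (#(U \ U') : ℝ) / (2 * t) = (1 / 2) * ((1 / t) * #(U \ U')) := by field_simp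
  unfold harmonicPotential
  linarith

/-- One round of sampling does not increase the expected potential. -/
theorem expect_round_le {H : Type*} [Fintype H] [Nonempty H] {𝒮 𝒟 : Finset (Finset α)} {t : ℕ}
    {p : ℝ} {z : H → Finset α → Bool} (hz : IsPairwiseSampling p z) (hp : 0 ≤ p) (ht : 0 < t)
    {U : Finset α} (hcov : ∀ x ∈ U, ∃ S ∈ 𝒟, x ∈ S) (hsmall : ∀ S ∈ 𝒟, #(S ∩ U) ≤ 2 * t) :
    𝔼 h, ((#(pickedSets 𝒮 t (z h) U) : ℝ) + (harmonicPotential 𝒟 (leftover 𝒮 t (z h) U) +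
      (1 / t) * ∑ x ∈ leftover 𝒮 t (z h) U, 2 * expectedDegree 𝒮 t p U x)) ≤
      roundPotential 𝒮 𝒟 t p U := by
  classical
  set E := eligibleSets 𝒮 t U with hE
  set a := expectedDegree 𝒮 t p U with ha
  have ha0 : ∀ x, 0 ≤ a x := expectedDegree_nonneg hp 𝒮 t U
  set c : H → α → ℝ := fun h x => if ∃ S ∈ {S ∈ E | x ∈ S}, z h S then (1 : ℝ) else 0 with hc
  set X : H → α → ℝ := fun h x => ∑ S ∈ {S ∈ E | x ∈ S}, (if z h S then (1 : ℝ) else 0) with hX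
  have hleft : ∀ h, leftover 𝒮 t (z h) U = {x ∈ U | ¬ ∃ S ∈ {S ∈ E | x ∈ S}, z h S} := by
    intro h
    ext x
    simp only [leftover, pickedSets, mem_filter, ← hE]
    constructor
    · rintro ⟨hx, h2⟩
      refine ⟨hx, ?_⟩
      rintro ⟨S, ⟨hS, hxS⟩, hzS⟩
      exact h2 S ⟨hS, hzS⟩ hxS
    · rintro ⟨hx, h2⟩
      exact ⟨hx, fun S hS hxS => h2 ⟨S, ⟨hS.1, hxS⟩, hS.2⟩⟩
  -- The balance per element: `X` pays for the picked sets, `2 * a` is carried on only if the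
  -- element stays uncovered (`c = 0`), and covering it releases `4`.
  have hpt : ∀ h, ((#(pickedSets 𝒮 t (z h) U) : ℝ) + (harmonicPotential 𝒟 (leftover 𝒮 t (z h) U) +
      (1 / t) * ∑ x ∈ leftover 𝒮 t (z h) U, 2 * a x)) ≤
      harmonicPotential 𝒟 U + (1 / t) * ∑ x ∈ U, (X h x + 2 * a x - (4 + 2 * a x) * c h x) := by
    intro h
    have h1 := card_pickedSets_le (𝒮 := 𝒮) ht (z h) U
    have h2 := harmonicPotential_add_le ht (leftover_subset 𝒮 t (z h) U) hcov hsmall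
    have hXe : ∀ x, (#{S ∈ pickedSets 𝒮 t (z h) U | x ∈ S} : ℝ) = X h x := by
      intro x
      rw [hX]
      simp only [pickedSets]
      rw [sum_boole, filter_filter, filter_filter]
      congr 3
      ext S
      exact and_comm
    simp only [hXe] at h1
    have hce : (#(U \ leftover 𝒮 t (z h) U) : ℝ) = ∑ x ∈ U, c h x := by
      rw [hc, sum_boole, hleft, ← filter_not]
      simp only [not_not]
    have hle : ∑ x ∈ leftover 𝒮 t (z h) U, 2 * a x = ∑ x ∈ U, (2 * a x - 2 * a x * c h x) := by
      rw [hleft, sum_filter]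
      refine sum_congr rfl fun x _ => ?_
      simp only [hc]
      split_ifs <;> simp_all
    rw [hce] at h2
    rw [hle]
    have h3 : ∑ x ∈ U, (X h x + 2 * a x - (4 + 2 * a x) * c h x) =
        ∑ x ∈ U, X h x - 4 * ∑ x ∈ U, c h x + ∑ x ∈ U, (2 * a x - 2 * a x * c h x) := by
      rw [mul_sum, ← sum_sub_distrib, ← sum_add_distrib]
      refine sum_congr rfl fun x _ => by ring
    rw [h3]
    linarith
  refine (expect_le_expect fun h _ => hpt h).trans ?_
  rw [expect_add_distrib, Fintype.expect_const, ← mul_expect, expect_sum_comm, roundPotential]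
  gcongr with x hx
  rw [expect_sub_distrib, expect_add_distrib, Fintype.expect_const, ← mul_expect]
  have h1 : 𝔼 h, X h x = a x := by
    simp only [hX]
    rw [expect_sum_comm, sum_congr rfl fun S _ => hz.1 S]
    simp [ha, expectedDegree, mul_comm, hE]
  have h2 : a x / (1 + a x) ≤ 𝔼 h, c h x := hz.le_expect_exists hp _
  rw [h1]
  have h3 : (4 + 2 * a x) * (a x / (1 + a x)) ≤ (4 + 2 * a x) * 𝔼 h, c h x :=
    mul_le_mul_of_nonneg_left h2 (by linarith [ha0 x])
  -- This identity dictates the correction term: it is what the balance leaves when the covering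
  -- probability is exactly `a / (1 + a)`.
  have h4 : a x * (a x - 1) / (a x + 1) = 3 * a x - (4 + 2 * a x) * (a x / (1 + a x)) := by
    have : 1 + a x ≠ 0 := by linarith [ha0 x]
    have : a x + 1 ≠ 0 := by linarith [ha0 x]
    field_simp
    ring
  linarith

/-- After a round that samples everything no set is eligible. -/
theorem card_inter_leftover_lt {𝒮 : Finset (Finset α)} {t : ℕ} (ht : 0 < t)
    {y : Finset α → Bool} (hy : ∀ S, y S) (U : Finset α) {S : Finset α} (hS : S ∈ 𝒮) :
    #(S ∩ leftover 𝒮 t y U) < t := by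
  by_contra hcon
  push Not at hcon
  have hel : S ∈ pickedSets 𝒮 t y U := by
    simp only [pickedSets, eligibleSets, mem_filter]
    exact ⟨⟨hS, hcon.trans (card_le_card (inter_subset_inter_left (leftover_subset 𝒮 t y U)))⟩,
      hy S⟩
  obtain ⟨x, hx⟩ : (S ∩ leftover 𝒮 t y U).Nonempty := card_pos.1 (by omega)
  simp only [leftover, mem_inter, mem_filter] at hx
  exact hx.2.2 S hel hx.1

theorem mul_sub_one_div_le {b : ℝ} (hb : 0 ≤ b) : b * (b - 1) / (b + 1) ≤ b := by
  rw [div_le_iff₀ (by linarith)]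
  nlinarith

theorem mul_sub_one_div_nonpos {b : ℝ} (hb : 0 ≤ b) (hb1 : b ≤ 1) : b * (b - 1) / (b + 1) ≤ 0 :=
  div_nonpos_of_nonpos_of_nonneg (mul_nonpos_of_nonneg_of_nonpos hb (by linarith)) (by linarith)

/-- For the start of a phase: all expected degrees are at most `1`, so every correction term is
nonpositive. -/
theorem roundPotential_le_of_mul_card_le_one {𝒮 𝒟 : Finset (Finset α)} {t : ℕ} {q : ℝ} (hq : 0 ≤ q)
    (h : q * #𝒮 ≤ 1) (U : Finset α) : roundPotential 𝒮 𝒟 t q U ≤ harmonicPotential 𝒟 U := by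
  have : ∑ x ∈ U, expectedDegree 𝒮 t q U x *
    (expectedDegree 𝒮 t q U x - 1) / (expectedDegree 𝒮 t q U x + 1) ≤ 0 := by
    refine sum_nonpos fun x _ => mul_sub_one_div_nonpos (expectedDegree_nonneg hq 𝒮 t U x) ?_
    refine le_trans ?_ h
    unfold expectedDegree
    gcongr
    exact (filter_subset _ _).trans (filter_subset _ _)
  have h2 : (1 / (t : ℝ)) * ∑ x ∈ U, expectedDegree 𝒮 t q U x *
    (expectedDegree 𝒮 t q U x - 1) / (expectedDegree 𝒮 t q U x + 1) ≤ 0 :=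
    mul_nonpos_of_nonneg_of_nonpos (by positivity) this
  unfold roundPotential
  linarith

/-- For the transition inside a phase: eligible families only shrink with `U`, so the degrees at
most double, and `b * (b - 1) / (b + 1) ≤ b`. -/
theorem roundPotential_le_of_le_two_mul {𝒮 𝒟 : Finset (Finset α)} {t : ℕ} {q q' : ℝ} (hq' : 0 ≤ q')
    (hqq : q' ≤ 2 * q) {U U' : Finset α} (hU : U' ⊆ U) :
    roundPotential 𝒮 𝒟 t q' U' ≤
      harmonicPotential 𝒟 U' + (1 / t) * ∑ x ∈ U', 2 * expectedDegree 𝒮 t q U x := by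
  unfold roundPotential
  gcongr with x hx
  refine (mul_sub_one_div_le (expectedDegree_nonneg hq' 𝒮 t U' x)).trans ?_
  unfold expectedDegree
  rw [← mul_assoc]
  have hq : 0 ≤ 2 * q := hq'.trans hqq
  gcongr
  exact eligibleSets_mono hU

end Round

/-! ### The sampling process over all rounds -/

theorem expect_eq_expect_update {ι H : Type*} [Fintype ι] [DecidableEq ι] [Fintype H] [Nonempty H]
    (i : ι) (f : (ι → H) → ℝ) : 𝔼 ω, f ω = 𝔼 ω, 𝔼 h, f (Function.update ω i h) := by
  classical
  rw [← expect_product' univ univ fun (ω : ι → H) (h : H) => f (Function.update ω i h)]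
  have h1 : 𝔼 ω, f ω = 𝔼 x ∈ (univ : Finset (ι → H)) ×ˢ (univ : Finset H), f x.1 := by
    rw [expect_product' univ univ fun (ω : ι → H) (_ : H) => f ω]
    simp
  rw [h1]
  -- Exchanging the `i`-th coordinate with the fresh sample is an involution of the product.
  refine expect_nbij' (fun x => (Function.update x.1 i x.2, x.1 i))
    (fun x => (Function.update x.1 i x.2, x.1 i)) ?_ ?_ ?_ ?_ ?_ <;> simp

section SamplingProcess

variable {α : Type*} [Fintype α] [DecidableEq α]

/-- The elements that are still uncovered at the start of a round, when round `r` uses the threshold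
`τ r` and samples the sets `S` with `y r S`. -/
def uncovered (𝒮 : Finset (Finset α)) (τ : ℕ → ℕ) (y : ℕ → Finset α → Bool) : ℕ → Finset α
  | 0 => univ
  | r + 1 => leftover 𝒮 (τ r) (y r) (uncovered 𝒮 τ y r)

/-- The sets that are picked in one of the first `T` rounds. -/
def coverAfter (𝒮 : Finset (Finset α)) (τ : ℕ → ℕ) (y : ℕ → Finset α → Bool) (T : ℕ) :
    Finset (Finset α) :=
  {S ∈ 𝒮 | ∃ r ∈ range T, τ r ≤ #(S ∩ uncovered 𝒮 τ y r) ∧ y r S}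

theorem uncovered_congr {𝒮 : Finset (Finset α)} {τ : ℕ → ℕ} {y y' : ℕ → Finset α → Bool} {t : ℕ}
    (h : ∀ r < t, y r = y' r) : uncovered 𝒮 τ y t = uncovered 𝒮 τ y' t := by
  induction t with
  | zero => rfl
  | succ t ih => rw [uncovered, uncovered, ih fun r hr => h r (by omega), h t (by omega)]

theorem card_coverAfter_le (𝒮 : Finset (Finset α)) (τ : ℕ → ℕ) (y : ℕ → Finset α → Bool) (T : ℕ) :
    #(coverAfter 𝒮 τ y T) ≤ ∑ r ∈ range T, #(pickedSets 𝒮 (τ r) (y r) (uncovered 𝒮 τ y r)) := by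
  refine (card_le_card ?_).trans card_biUnion_le
  intro S hS
  simp only [coverAfter, mem_filter] at hS
  obtain ⟨hS, r, hr, h1, h2⟩ := hS
  exact mem_biUnion.2 ⟨r, hr, by simp [pickedSets, eligibleSets, hS, h1, h2]⟩

theorem exists_mem_coverAfter (𝒮 : Finset (Finset α)) (τ : ℕ → ℕ) (y : ℕ → Finset α → Bool)
    (T : ℕ) (x : α) (hx : x ∉ uncovered 𝒮 τ y T) : ∃ S ∈ coverAfter 𝒮 τ y T, x ∈ S := by
  induction T with
  | zero => simp [uncovered] at hx
  | succ T ih =>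
    by_cases hxT : x ∈ uncovered 𝒮 τ y T
    · simp only [uncovered, leftover, mem_filter, hxT, true_and, not_forall, not_not] at hx
      obtain ⟨S, hS, hxS⟩ := hx
      simp only [pickedSets, eligibleSets, mem_filter] at hS
      refine ⟨S, ?_, hxS⟩
      simp only [coverAfter, mem_filter]
      exact ⟨hS.1.1, T, by simp, hS.1.2, hS.2⟩
    · obtain ⟨S, hS, hxS⟩ := ih hxT
      refine ⟨S, ?_, hxS⟩
      simp only [coverAfter, mem_filter, mem_range] at hS ⊢
      obtain ⟨h1, r, hr, h2⟩ := hS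
      exact ⟨h1, r, by omega, h2⟩

/-- A schedule of thresholds and sampling probabilities: within a phase the probability at most
doubles; before a new phase, in which the threshold is at least half of the old one, everything is
sampled, and the new probability is small. -/
structure IsSamplingSchedule {H : Type*} [Fintype H] (m : ℕ) (τ : ℕ → ℕ) (p : ℕ → ℝ)
    (z : ℕ → H → Finset α → Bool) : Prop where
  sampling : ∀ r, IsPairwiseSampling (p r) (z r)
  nonneg : ∀ r, 0 ≤ p r
  pos : ∀ r, 0 < τ r
  start : Fintype.card α ≤ 2 * τ 0 ∧ p 0 * m ≤ 1
  step : ∀ r, (τ (r + 1) = τ r ∧ p (r + 1) ≤ 2 * p r) ∨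
    ((∀ h S, z r h S) ∧ τ r ≤ 2 * τ (r + 1) ∧ p (r + 1) * m ≤ 1)

variable {H : Type*} [Fintype H] {m : ℕ} {τ : ℕ → ℕ} {p : ℕ → ℝ} {z : ℕ → H → Finset α → Bool}

/-- The invariant that the harmonic estimate needs. It survives a change of phase because full
sampling leaves fewer than `τ r ≤ 2 * τ (r + 1)` uncovered elements in each set. -/
theorem IsSamplingSchedule.card_inter_uncovered_le (hs : IsSamplingSchedule m τ p z)
    (𝒮 : Finset (Finset α)) (s : ℕ → H) (r : ℕ) {S : Finset α} (hS : S ∈ 𝒮) :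
    #(S ∩ uncovered 𝒮 τ (fun r => z r (s r)) r) ≤ 2 * τ r := by
  induction r with
  | zero => exact (card_le_univ _).trans hs.start.1
  | succ r ih =>
    rcases hs.step r with ⟨h1, -⟩ | ⟨h1, h2, -⟩
    · rw [h1]
      refine (card_le_card ?_).trans ih
      exact inter_subset_inter_left (leftover_subset _ _ _ _)
    · exact (card_inter_leftover_lt (hs.pos r) (h1 (s r)) _ hS).le.trans h2

variable [Nonempty H] {T : ℕ} [NeZero T]

/-- The supermartingale bound. Given the earlier seeds, only coordinate `t` influences round `t`;
`Fin.ofNat T` is injective on the rounds below `T`, so the seeds of different rounds are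
independent. -/
theorem IsSamplingSchedule.expect_sum_card_add_potential_le (hs : IsSamplingSchedule m τ p z)
    {𝒮 𝒟 : Finset (Finset α)} (h𝒮 : #𝒮 ≤ m) (h𝒟 : 𝒟 ⊆ 𝒮) (hcov : ∀ x, ∃ S ∈ 𝒟, x ∈ S) (t : ℕ)
    (ht : t ≤ T) :
    𝔼 ω : Fin T → H, ((∑ r ∈ range t, (#(pickedSets 𝒮 (τ r) (z r (ω (Fin.ofNat T r)))
        (uncovered 𝒮 τ (fun r => z r (ω (Fin.ofNat T r))) r)) : ℝ)) +
      roundPotential 𝒮 𝒟 (τ t) (p t) (uncovered 𝒮 τ (fun r => z r (ω (Fin.ofNat T r))) t)) ≤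
      harmonicPotential 𝒟 univ := by
  have hm : ∀ {q : ℝ}, 0 ≤ q → q * m ≤ 1 → q * #𝒮 ≤ 1 := fun hq h =>
    le_trans (by gcongr) h
  induction t with
  | zero =>
    simp only [range_zero, sum_empty, zero_add, uncovered]
    rw [Fintype.expect_const]
    exact roundPotential_le_of_mul_card_le_one (hs.nonneg 0) (hm (hs.nonneg 0) hs.start.2) _
  | succ t ih =>
    refine le_trans ?_ (ih (by omega))
    -- Resampling coordinate `t` replaces conditioning on the past.
    rw [expect_eq_expect_update (Fin.ofNat T t)]
    refine expect_le_expect fun ω _ => ?_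
    set U := uncovered 𝒮 τ (fun r => z r (ω (Fin.ofNat T r))) t with hU
    have hne : ∀ r < t, Fin.ofNat T r ≠ Fin.ofNat T t := by
      intro r hr h
      have := congrArg Fin.val h
      simp only [Fin.val_ofNat] at this
      rw [Nat.mod_eq_of_lt (by omega), Nat.mod_eq_of_lt (by omega)] at this
      omega
    have hupd : ∀ h : H, ∀ r ≤ t, uncovered 𝒮 τ
        (fun r => z r (Function.update ω (Fin.ofNat T t) h (Fin.ofNat T r))) r =
        uncovered 𝒮 τ (fun r => z r (ω (Fin.ofNat T r))) r := by
      intro h r hr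
      refine uncovered_congr fun r' hr' => ?_
      rw [Function.update_of_ne (hne r' (by omega))]
    have hstep : ∀ h : H,
        (∑ r ∈ range (t + 1), (#(pickedSets 𝒮 (τ r)
          (z r (Function.update ω (Fin.ofNat T t) h (Fin.ofNat T r)))
          (uncovered 𝒮 τ
            (fun r => z r (Function.update ω (Fin.ofNat T t) h (Fin.ofNat T r))) r)) : ℝ)) +
        roundPotential 𝒮 𝒟 (τ (t + 1)) (p (t + 1)) (uncovered 𝒮 τ
          (fun r => z r (Function.update ω (Fin.ofNat T t) h (Fin.ofNat T r))) (t + 1)) ≤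
        (∑ r ∈ range t, (#(pickedSets 𝒮 (τ r) (z r (ω (Fin.ofNat T r)))
          (uncovered 𝒮 τ (fun r => z r (ω (Fin.ofNat T r))) r)) : ℝ)) +
        ((#(pickedSets 𝒮 (τ t) (z t h) U) : ℝ) +
          (harmonicPotential 𝒟 (leftover 𝒮 (τ t) (z t h) U) +
          (1 / τ t) * ∑ x ∈ leftover 𝒮 (τ t) (z t h) U,
            2 * expectedDegree 𝒮 (τ t) (p t) U x)) := by
      intro h
      rw [sum_range_succ, uncovered, hupd h t le_rfl, Function.update_self, ← hU]
      have h1 : ∑ r ∈ range t, (#(pickedSets 𝒮 (τ r)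
          (z r (Function.update ω (Fin.ofNat T t) h (Fin.ofNat T r)))
          (uncovered 𝒮 τ
            (fun r => z r (Function.update ω (Fin.ofNat T t) h (Fin.ofNat T r))) r)) : ℝ) =
          ∑ r ∈ range t, (#(pickedSets 𝒮 (τ r) (z r (ω (Fin.ofNat T r)))
          (uncovered 𝒮 τ (fun r => z r (ω (Fin.ofNat T r))) r)) : ℝ) := by
        refine sum_congr rfl fun r hr => ?_
        have hr := mem_range.1 hr
        rw [hupd h r hr.le, Function.update_of_ne (hne r hr)]
      rw [h1, add_assoc]
      gcongr
      -- Inside a phase the terms `2 * a` pay for the doubling; at a change of phase they are simply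
      -- dropped as nonnegative.
      rcases hs.step t with ⟨h2, h3⟩ | ⟨-, -, h3⟩
      · rw [h2]
        exact roundPotential_le_of_le_two_mul (hs.nonneg _) h3 (leftover_subset _ _ _ _)
      · refine (roundPotential_le_of_mul_card_le_one (hs.nonneg _)
          (hm (hs.nonneg _) h3) _).trans ?_
        rw [le_add_iff_nonneg_right]
        have := expectedDegree_nonneg (hs.nonneg t) 𝒮 (τ t) U
        exact mul_nonneg (by positivity) (sum_nonneg fun x _ => by linarith [this x])
    refine (expect_le_expect fun h _ => hstep h).trans ?_
    rw [expect_add_distrib, Fintype.expect_const]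
    gcongr
    exact expect_round_le (hs.sampling t) (hs.nonneg t) (hs.pos t) (fun x _ => hcov x)
      fun S hS => hs.card_inter_uncovered_le 𝒮 (fun r => ω (Fin.ofNat T r)) t (h𝒟 hS)

/-- If the last round has threshold one and samples everything, everything is covered. -/
theorem uncovered_eq_empty {𝒮 : Finset (Finset α)} {y : ℕ → Finset α → Bool} {t : ℕ} (ht : τ t = 1)
    (hy : ∀ S, y t S) (hcov : ∀ x, ∃ S ∈ 𝒮, x ∈ S) : uncovered 𝒮 τ y (t + 1) = ∅ := by
  rw [eq_empty_iff_forall_notMem]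
  intro x hx
  obtain ⟨S, hS, hxS⟩ := hcov x
  have := card_inter_leftover_lt (t := τ t) (by omega) hy (uncovered 𝒮 τ y t) hS
  rw [ht, Nat.lt_one_iff, card_eq_zero] at this
  have hx' : x ∈ S ∩ leftover 𝒮 1 (y t) (uncovered 𝒮 τ y t) := by
    rw [uncovered, ht] at hx
    exact mem_inter.2 ⟨hxS, hx⟩
  rw [this] at hx'
  simp at hx'

/-- The expected size of the computed cover. -/
theorem IsSamplingSchedule.expect_card_coverAfter_le (hs : IsSamplingSchedule m τ p z)
    {𝒮 𝒟 : Finset (Finset α)} (h𝒮 : #𝒮 ≤ m) (h𝒟 : 𝒟 ⊆ 𝒮) (hcov : ∀ x, ∃ S ∈ 𝒟, x ∈ S)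
    (hT : τ (T - 1) = 1) (hz : ∀ h S, z (T - 1) h S) :
    𝔼 ω : Fin T → H, (#(coverAfter 𝒮 τ (fun r => z r (ω (Fin.ofNat T r))) T) : ℝ) ≤
      8 * (1 + Real.log (Fintype.card α)) * #𝒟 := by
  have hT1 : T = T - 1 + 1 := by have := NeZero.pos T; omega
  refine le_trans (expect_le_expect (g := fun ω : Fin T → H => (∑ r ∈ range T,
    (#(pickedSets 𝒮 (τ r) (z r (ω (Fin.ofNat T r)))
        (uncovered 𝒮 τ (fun r => z r (ω (Fin.ofNat T r))) r)) : ℝ)) +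
      roundPotential 𝒮 𝒟 (τ T) (p T) (uncovered 𝒮 τ (fun r => z r (ω (Fin.ofNat T r))) T))
      fun ω _ => ?_) ((hs.expect_sum_card_add_potential_le h𝒮 h𝒟 hcov T le_rfl).trans ?_)
  · have h0 : uncovered 𝒮 τ (fun r => z r (ω (Fin.ofNat T r))) T = ∅ := by
      have := uncovered_eq_empty (y := fun r => z r (ω (Fin.ofNat T r))) hT (hz _) fun x =>
        (hcov x).imp fun S hS => ⟨h𝒟 hS.1, hS.2⟩
      rwa [← hT1] at this
    rw [h0]
    simp only [roundPotential, harmonicPotential, inter_empty, card_empty, harmonic_zero,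
      Rat.cast_zero, sum_const_zero, sum_empty, mul_zero, add_zero]
    exact_mod_cast card_coverAfter_le 𝒮 τ (fun r => z r (ω (Fin.ofNat T r))) T
  · unfold harmonicPotential
    rw [mul_assoc, mul_comm _ (#𝒟 : ℝ), ← nsmul_eq_mul]
    gcongr
    apply sum_le_card_nsmul
    intro S hS
    refine (harmonic_le_one_add_log _).trans ?_
    gcongr 1 + ?_
    rw [inter_univ]
    -- The empty set is harmless thanks to the convention `Real.log 0 = 0`.
    rcases Nat.eq_zero_or_pos #S with h | h
    · simp only [h, Nat.cast_zero, Real.log_zero]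
      exact Real.log_natCast_nonneg _
    · exact Real.log_le_log (by exact_mod_cast h) (by exact_mod_cast card_le_univ S)

end SamplingProcess

/-! ### Hash tables, independent repetition and amplification -/

theorem card_filter_forall_apply {ι H : Type*} [Fintype ι] [DecidableEq ι] [Fintype H]
    (P : H → Prop) [DecidablePred P] :
    #{ω : ι → H | ∀ i, P (ω i)} = #{h | P h} ^ Fintype.card ι := by
  rw [← card_univ, ← prod_const, ← Fintype.card_piFinset]
  congr 1
  ext ω
  simp [Fintype.mem_piFinset]

theorem card_filter_forall_apply_mul_two_pow_le {ι H : Type*} [Fintype ι] [DecidableEq ι] [Fintype H]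
    {P : H → Prop} [DecidablePred P] (h : #{h | P h} * 2 ≤ Fintype.card H) :
    #{ω : ι → H | ∀ i, P (ω i)} * 2 ^ Fintype.card ι ≤ Fintype.card (ι → H) := by
  rw [card_filter_forall_apply, ← mul_pow, Fintype.card_fun]
  exact Nat.pow_le_pow_left h _

section Hash

variable {α : Type*} [Fintype α] [DecidableEq α] {N : ℕ} [NeZero N]

theorem isPairwiseSampling_linearHash {k : ℕ} (hk : k ≤ N) :
    IsPairwiseSampling ((k : ℝ) / N)
      (fun (h : HashSeed α N) (S : Finset α) => decide ((linearHash h S).val < k)) := by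
  classical
  have hN : (0 : ℝ) < N := by exact_mod_cast NeZero.pos N
  have hH : (0 : ℝ) < Fintype.card (HashSeed α N) := by exact_mod_cast Fintype.card_pos
  set X : Finset (ZMod N) := {a | a.val < k} with hX
  have hcard : #X = k := by
    rw [← card_range k]
    refine card_bij (fun a _ => a.val) (by simp [hX])
      (fun a _ b _ h => ZMod.val_injective N h) fun b hb => ⟨(b : ZMod N), ?_, ?_⟩
    · have hb := mem_range.1 hb
      simp only [hX, mem_filter, mem_univ, true_and]
      rwa [ZMod.val_cast_of_lt (by omega)]
    · have hb := mem_range.1 hb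
      exact ZMod.val_cast_of_lt (by omega)
  constructor
  · intro S
    have h := card_linearHash_mem (N := N) S X
    rw [hcard] at h
    simp only [hX, mem_filter, mem_univ, true_and] at h
    have h' : (#{h : HashSeed α N | (linearHash h S).val < k} : ℝ) * N =
      k * Fintype.card (HashSeed α N) := by exact_mod_cast h
    simp only [decide_eq_true_eq]
    rw [Fintype.expect_eq_sum_div_card, sum_boole, div_eq_div_iff hH.ne' hN.ne', h']
  · intro S T hST
    have h := card_linearHash_pair_mem (N := N) hST (X ×ˢ X)
    rw [card_product, hcard] at h
    simp only [hX, mem_product, mem_filter, mem_univ, true_and] at h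
    have h' : (#{h : HashSeed α N | (linearHash h S).val < k ∧ (linearHash h T).val < k} : ℝ) *
      (N * N) = k * k * Fintype.card (HashSeed α N) := by exact_mod_cast h
    simp only [decide_eq_true_eq, ite_zero_mul_ite_zero, mul_one]
    rw [Fintype.expect_eq_sum_div_card, sum_boole, div_mul_div_comm,
      div_eq_div_iff hH.ne' (by positivity), h']

theorem card_filter_exists_collision_mul_le (𝒞 : Finset (Finset α)) (S : Finset α) :
    #{h : HashSeed α N | ∃ T ∈ 𝒞, T ≠ S ∧ linearHash h T = linearHash h S} * N ≤
      #𝒞 * Fintype.card (HashSeed α N) := by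
  classical
  have h1 : #{h : HashSeed α N | ∃ T ∈ 𝒞, T ≠ S ∧ linearHash h T = linearHash h S} ≤
      ∑ T ∈ 𝒞, #{h : HashSeed α N | T ≠ S ∧ linearHash h T = linearHash h S} := by
    refine (card_le_card ?_).trans card_biUnion_le
    intro h
    simp
  refine (Nat.mul_le_mul_right N h1).trans ?_
  rw [sum_mul, ← smul_eq_mul (#𝒞)]
  refine sum_le_card_nsmul _ _ _ fun T _ => ?_
  by_cases hT : T = S
  · simp [hT]
  · simp only [ne_eq, hT, not_false_eq_true, true_and]
    exact (card_linearHash_collision hT).le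

/-- Sets without a collision have distinct hash values, so a small image forces at least half of the
sets to collide. The expected number of colliding sets is at most `#𝒞 ^ 2 / N ≤ #𝒞 / 4`, and
Markov's inequality applies. -/
theorem card_filter_image_small_mul_two_le (𝒞 : Finset (Finset α)) (h𝒞 : 4 * #𝒞 ≤ N) :
    #{h : HashSeed α N | 2 * #(𝒞.image (linearHash h)) < #𝒞} * 2 ≤
      Fintype.card (HashSeed α N) := by
  classical
  set bad : Finset (HashSeed α N) := {h | 2 * #(𝒞.image (linearHash h)) < #𝒞} with hbad
  rcases Nat.eq_zero_or_pos #𝒞 with h0 | h0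
  · have : bad = ∅ := by simp [hbad, h0]
    simp [this]
  have h1 : ∀ h ∈ bad, #𝒞 ≤ 2 * #{S ∈ 𝒞 | ∃ T ∈ 𝒞, T ≠ S ∧ linearHash h T = linearHash h S} := by
    intro h hh
    simp only [hbad, mem_filter, mem_univ, true_and] at hh
    have h2 : #{S ∈ 𝒞 | ¬ ∃ T ∈ 𝒞, T ≠ S ∧ linearHash h T = linearHash h S} ≤
        #(𝒞.image (linearHash h)) := by
      rw [← card_image_of_injOn (f := linearHash h)
        (s := {S ∈ 𝒞 | ¬ ∃ T ∈ 𝒞, T ≠ S ∧ linearHash h T = linearHash h S})]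
      · exact card_le_card (image_subset_image (filter_subset _ _))
      · intro S hS T hT hST
        by_contra hne
        simp only [coe_filter, Set.mem_ofPred_eq] at hS hT
        exact hT.2 ⟨S, hS.1, hne, hST⟩
    have h3 := card_filter_add_card_filter_not (s := 𝒞)
      (fun S => ∃ T ∈ 𝒞, T ≠ S ∧ linearHash h T = linearHash h S)
    omega
  have h2 : #bad * #𝒞 ≤
      ∑ h : HashSeed α N, 2 * #{S ∈ 𝒞 | ∃ T ∈ 𝒞, T ≠ S ∧ linearHash h T = linearHash h S} := by
    rw [← smul_eq_mul]
    exact (card_nsmul_le_sum _ _ _ h1).trans (sum_le_sum_of_subset (subset_univ _))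
  rw [← mul_sum] at h2
  have h3 := sum_card_bipartiteAbove_eq_sum_card_bipartiteBelow
    (s := (univ : Finset (HashSeed α N))) (t := 𝒞)
    (fun h S => ∃ T ∈ 𝒞, T ≠ S ∧ linearHash h T = linearHash h S)
  simp only [bipartiteAbove, bipartiteBelow] at h3
  rw [h3] at h2
  have h4 : (∑ S ∈ 𝒞, #{h : HashSeed α N | ∃ T ∈ 𝒞, T ≠ S ∧ linearHash h T = linearHash h S}) * N ≤
      #𝒞 * (#𝒞 * Fintype.card (HashSeed α N)) := by
    rw [sum_mul, ← smul_eq_mul (#𝒞)]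
    exact sum_le_card_nsmul _ _ _ fun S _ => card_filter_exists_collision_mul_le 𝒞 S
  have hN : 0 < N := NeZero.pos N
  have h5 : #bad * N ≤ 2 * (#𝒞 * Fintype.card (HashSeed α N)) := by
    apply Nat.le_of_mul_le_mul_left _ h0
    nlinarith
  apply Nat.le_of_mul_le_mul_left _ hN
  nlinarith

/-- Passing to a subfamily of size `min #𝒞 b` lets tables of `4 * b` buckets also expose families
that are too large for them. -/
theorem card_filter_image_lt_min_mul_two_le (𝒞 : Finset (Finset α)) {b : ℕ} (hb : 4 * b ≤ N) :
    #{h : HashSeed α N | 2 * #(𝒞.image (linearHash h)) < min #𝒞 b} * 2 ≤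
      Fintype.card (HashSeed α N) := by
  classical
  obtain ⟨𝒞', hsub, hcard⟩ := exists_subset_card_eq (min_le_left #𝒞 b)
  refine le_trans (Nat.mul_le_mul_right _ (card_le_card ?_))
    (card_filter_image_small_mul_two_le 𝒞' (N := N)
      (by rw [hcard]; have := min_le_right #𝒞 b; omega))
  intro h
  simp only [mem_filter, mem_univ, true_and, hcard]
  have := card_le_card (image_subset_image (f := linearHash h) hsub)
  omega

end Hash

section Amplification

variable {α Ω : Type*} [Fintype α] [DecidableEq α] [Fintype Ω] {N J L : ℕ} [NeZero N]

/-- The random choices are good: one of the families is small, hash tables give a lower bound on the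
size of each family, and they separate the small families from the sets in `𝒳`. -/
def GoodChoices (𝒞 : Ω → Finset (Finset α)) (M : ℝ) (b : ℕ) (𝒳 : Finset (Finset α))
    (x : (Fin J → Ω) × (Fin L → HashSeed α N)) : Prop :=
  (∃ j, (#(𝒞 (x.1 j)) : ℝ) ≤ M) ∧
    ∀ j, (∃ l, min #(𝒞 (x.1 j)) b ≤ 2 * #((𝒞 (x.1 j)).image (linearHash (x.2 l)))) ∧
      (#(𝒞 (x.1 j)) ≤ b → ∀ X ∈ 𝒳, ∃ l, ∀ T ∈ 𝒞 (x.1 j),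
        linearHash (x.2 l) T ≠ linearHash (x.2 l) X)

-- Union bound: all `J` families are large with probability at most `2 ^ (-J)`; for fixed families
-- there are `J * (1 + #𝒳)` table failures of probability at most `2 ^ (-L)`, together again at most
-- `2 ^ (-J)`.
open Classical in
theorem card_not_goodChoices_le {𝒞 : Ω → Finset (Finset α)} {M : ℝ} {b : ℕ}
    {𝒳 : Finset (Finset α)} (hM : #{ω | M < #(𝒞 ω)} * 2 ≤ Fintype.card Ω)
    (h𝒳 : ∀ ω, ∀ X ∈ 𝒳, X ∉ 𝒞 ω) (hb : 4 * b ≤ N) {L' : ℕ} (hL : L = J + L')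
    (hJ : J * (1 + #𝒳) ≤ 2 ^ L') :
    #{x : (Fin J → Ω) × (Fin L → HashSeed α N) | ¬ GoodChoices 𝒞 M b 𝒳 x} * 2 ^ J ≤
      2 * Fintype.card ((Fin J → Ω) × (Fin L → HashSeed α N)) := by
  set A : Finset (Fin J → Ω) := {ω | ∀ j, M < #(𝒞 (ω j))} with hA
  set B1 : Ω → Finset (Fin L → HashSeed α N) := fun ω =>
    {ρ | ∀ l, 2 * #((𝒞 ω).image (linearHash (ρ l))) < min #(𝒞 ω) b} with hB1
  -- The default `∅` makes the bound on `B2` hold for all `ω` and `X`, including the pairs for which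
  -- no separation is required.
  set B2 : Ω → Finset α → Finset (Fin L → HashSeed α N) := fun ω X =>
    if #(𝒞 ω) ≤ b ∧ X ∈ 𝒳 then
      univ.filter fun ρ => ∀ l, ∃ T ∈ 𝒞 ω, T ≠ X ∧ linearHash (ρ l) T = linearHash (ρ l) X
    else ∅ with hB2
  have hAc : #A * 2 ^ J ≤ Fintype.card (Fin J → Ω) := by
    have := card_filter_forall_apply_mul_two_pow_le (ι := Fin J) hM
    rw [Fintype.card_fin] at this
    convert this
  have hB1c : ∀ ω, #(B1 ω) * 2 ^ L ≤ Fintype.card (Fin L → HashSeed α N) := by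
    intro ω
    have := card_filter_forall_apply_mul_two_pow_le (ι := Fin L)
      (card_filter_image_lt_min_mul_two_le (𝒞 ω) hb)
    rw [Fintype.card_fin] at this
    convert this
  have hB2c : ∀ ω X, #(B2 ω X) * 2 ^ L ≤ Fintype.card (Fin L → HashSeed α N) := by
    intro ω X
    simp only [hB2]
    split_ifs with h
    · have h1 := card_filter_exists_collision_mul_le (N := N) (𝒞 ω) X
      have h2 : #{h : HashSeed α N | ∃ T ∈ 𝒞 ω, T ≠ X ∧ linearHash h T = linearHash h X} * 2 ≤
          Fintype.card (HashSeed α N) := by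
        apply Nat.le_of_mul_le_mul_right _ (NeZero.pos N)
        have h3 : #(𝒞 ω) * Fintype.card (HashSeed α N) ≤ b * Fintype.card (HashSeed α N) :=
          Nat.mul_le_mul_right _ h.1
        nlinarith
      have := card_filter_forall_apply_mul_two_pow_le (ι := Fin L) h2
      rw [Fintype.card_fin] at this
      convert this
    · simp
  set D : (Fin J → Ω) → Finset (Fin L → HashSeed α N) := fun ω =>
    univ.biUnion fun j => B1 (ω j) ∪ 𝒳.biUnion fun X => B2 (ω j) X with hD
  have hDc : ∀ ω, #(D ω) * 2 ^ J ≤ Fintype.card (Fin L → HashSeed α N) := by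
    intro ω
    have h1 : ∀ j, #(B1 (ω j) ∪ 𝒳.biUnion fun X => B2 (ω j) X) * 2 ^ L ≤
        (1 + #𝒳) * Fintype.card (Fin L → HashSeed α N) := by
      intro j
      have h2 : #(B1 (ω j) ∪ 𝒳.biUnion fun X => B2 (ω j) X) ≤
          #(B1 (ω j)) + ∑ X ∈ 𝒳, #(B2 (ω j) X) :=
        (card_union_le _ _).trans (Nat.add_le_add_left card_biUnion_le _)
      refine (Nat.mul_le_mul_right _ h2).trans ?_
      rw [add_mul, add_mul, one_mul, sum_mul, ← smul_eq_mul (#𝒳)]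
      exact Nat.add_le_add (hB1c _) (sum_le_card_nsmul _ _ _ fun X _ => hB2c _ X)
    have h3 : #(D ω) * 2 ^ L ≤ J * ((1 + #𝒳) * Fintype.card (Fin L → HashSeed α N)) := by
      refine (Nat.mul_le_mul_right _ card_biUnion_le).trans ?_
      rw [sum_mul]
      refine (sum_le_card_nsmul _ _ _ fun j _ => h1 j).trans ?_
      simp
    apply Nat.le_of_mul_le_mul_right _ (pow_pos (by norm_num : 0 < 2) L')
    rw [mul_assoc, ← pow_add, ← hL]
    refine h3.trans ?_
    rw [← mul_assoc, mul_comm (Fintype.card _)]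
    exact Nat.mul_le_mul_right _ hJ
  have hsub : ({x : (Fin J → Ω) × (Fin L → HashSeed α N) | ¬ GoodChoices 𝒞 M b 𝒳 x} : Finset _) ⊆
      (A ×ˢ univ) ∪ univ.filter fun x => x.2 ∈ D x.1 := by
    rintro ⟨ω, ρ⟩ hx
    simp only [mem_filter, mem_univ, true_and] at hx
    by_contra hcon
    apply hx
    simp only [mem_union, mem_product, mem_univ, and_true, mem_filter, true_and, not_or] at hcon
    obtain ⟨h1, h2⟩ := hcon
    simp only [hA, mem_filter, mem_univ, true_and, not_forall, not_lt] at h1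
    refine ⟨h1, fun j => ⟨?_, fun hj X hX => ?_⟩⟩
    · by_contra hcon
      push Not at hcon
      exact h2 (mem_biUnion.2 ⟨j, mem_univ _, mem_union_left _ (by simpa [hB1] using hcon)⟩)
    · by_contra hcon
      push Not at hcon
      refine h2 (mem_biUnion.2 ⟨j, mem_univ _, mem_union_right _
        (mem_biUnion.2 ⟨X, hX, ?_⟩)⟩)
      simp only [hB2, hj, hX, and_self, if_true, mem_filter, mem_univ, true_and]
      intro l
      obtain ⟨T, hT, hTX⟩ := hcon l
      exact ⟨T, hT, fun h => h𝒳 _ X hX (h ▸ hT), hTX⟩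
  have hfib : #(univ.filter fun x : (Fin J → Ω) × (Fin L → HashSeed α N) => x.2 ∈ D x.1) =
      ∑ ω, #(D ω) := by
    rw [← card_sigma]
    refine card_bij' (fun x _ => ⟨x.1, x.2⟩) (fun x _ => (x.1, x.2)) ?_ ?_ ?_ ?_ <;> simp
  have h1 : #{x : (Fin J → Ω) × (Fin L → HashSeed α N) | ¬ GoodChoices 𝒞 M b 𝒳 x} ≤
      #A * Fintype.card (Fin L → HashSeed α N) + ∑ ω, #(D ω) := by
    refine (card_le_card hsub).trans ((card_union_le _ _).trans ?_)
    rw [hfib, card_product, card_univ]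
  refine (Nat.mul_le_mul_right _ h1).trans ?_
  rw [add_mul, two_mul, Fintype.card_prod, sum_mul]
  refine Nat.add_le_add ?_ ?_
  · rw [mul_right_comm]
    exact Nat.mul_le_mul_right _ hAc
  · refine (sum_le_card_nsmul _ _ _ fun ω _ => hDc ω).trans ?_
    rw [card_univ, smul_eq_mul]

/-- Markov's inequality for the uniform distribution. -/
theorem card_filter_two_mul_lt_mul_two_le [Nonempty Ω] {f : Ω → ℝ} (hf : ∀ ω, 0 ≤ f ω) {E : ℝ}
    (hE : 𝔼 ω, f ω ≤ E) : #{ω | 2 * E < f ω} * 2 ≤ Fintype.card Ω := by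
  classical
  rw [Fintype.expect_eq_sum_div_card, div_le_iff₀ (by exact_mod_cast Fintype.card_pos)] at hE
  have h0 : 0 ≤ E * Fintype.card Ω := (sum_nonneg fun ω _ => hf ω).trans hE
  have hE0 : 0 ≤ E := nonneg_of_mul_nonneg_left h0 (by exact_mod_cast Fintype.card_pos)
  have h1 : (#{ω | 2 * E < f ω} : ℝ) * (2 * E) ≤ E * Fintype.card Ω := by
    refine le_trans ?_ hE
    rw [← nsmul_eq_mul]
    refine (card_nsmul_le_sum _ _ _ fun ω hω => ?_).trans
      (sum_le_sum_of_subset_of_nonneg (filter_subset (fun ω => 2 * E < f ω) univ)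
        fun ω _ _ => hf ω)
    exact (mem_filter.1 hω).2.le
  -- With `E = 0` there is nothing to divide by, but then `f` vanishes identically.
  rcases hE0.eq_or_lt with h | h
  · have hz : ∀ ω ∈ univ, f ω = 0 := by
      refine (sum_eq_zero_iff_of_nonneg fun ω _ => hf ω).1 (le_antisymm ?_ (sum_nonneg fun ω _ => hf ω))
      rw [← h] at hE
      linarith
    have : ({ω | 2 * E < f ω} : Finset Ω) = ∅ := by
      refine filter_eq_empty_iff.2 fun ω hω => ?_
      rw [hz ω hω, ← h]; simp
    simp [this]
  · have : (#{ω | 2 * E < f ω} : ℝ) * 2 ≤ Fintype.card Ω := by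
      apply le_of_mul_le_mul_left _ h
      linarith
    exact_mod_cast this

end Amplification

/-! ### The sketch and its correctness -/

/-- A counter modulo a large number vanishes only if nothing is counted. -/
theorem sum_zsmul_ite_eq_zero_iff {ι : Type*} [Fintype ι] {Q : ℕ} {f : ι → ℤ} (hf : ∀ i, 0 ≤ f i)
    (hQ : ∑ i, f i < Q) (P : ι → Prop) [DecidablePred P] :
    ∑ i, f i • (if P i then (1 : ZMod Q) else 0) = 0 ↔ ∀ i, 0 < f i → ¬ P i := by
  have h1 : ∑ i, f i • (if P i then (1 : ZMod Q) else 0) =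
      ((∑ i, if P i then f i else 0 : ℤ) : ZMod Q) := by
    push_cast
    refine sum_congr rfl fun i _ => ?_
    split_ifs <;> simp
  have h2 : ∀ i ∈ univ, 0 ≤ if P i then f i else 0 := fun i _ => by
    split_ifs
    · exact hf i
    · exact le_rfl
  have h3 : (∑ i, if P i then f i else 0 : ℤ) < Q := by
    refine lt_of_le_of_lt (sum_le_sum fun i _ => ?_) hQ
    split_ifs
    · exact le_rfl
    · exact hf i
  rw [h1, ZMod.intCast_zmod_eq_zero_iff_dvd]
  constructor
  · intro hd i hi hP
    have h4 := Int.eq_zero_of_dvd_of_nonneg_of_lt (sum_nonneg h2) h3 hd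
    have h5 := (sum_eq_zero_iff_of_nonneg h2).1 h4 i (mem_univ i)
    rw [if_pos hP] at h5
    omega
  · intro h
    rw [sum_eq_zero]
    · exact dvd_zero _
    intro i _
    split_ifs with hP
    · have := h i
      have := hf i
      by_contra hne
      exact h i (by omega) hP
    · rfl

namespace CoverSketch

variable {n J T L B Q : ℕ} {H : Type}

/-- The random seeds: one for every copy and round, and those of the final hash tables. -/
abbrev Seeds (n J T L B : ℕ) (H : Type) : Type :=
  (Fin J → Fin T → H) × (Fin L → HashSeed (Fin n) B)

/-- What is remembered between passes: the seeds, for every copy the uncovered elements at the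
start of each round, and for every copy the hash tables of its cover. -/
abbrev Knowledge (n J T L B Q : ℕ) (H : Type) : Type :=
  Seeds n J T L B H × (Fin J → Fin T → Finset (Fin n)) × (Fin J → Fin L → ZMod B → ZMod Q)

/-- The counters of a pass: for every copy, round and element the number of picked sets that contain
the element, and the hash tables. -/
abbrev Counters (n J T L B Q : ℕ) : Type :=
  (Fin J → Fin T → Fin n → ZMod Q) × (Fin J → Fin L → ZMod B → ZMod Q)

/-- Whether a set is picked by a copy in a round, given the uncovered elements. -/
def IsPicked (τ : ℕ → ℕ) (z : ℕ → H → Finset (Fin n) → Bool) (ω : Fin T → H)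
    (U : Fin T → Finset (Fin n)) (S : Finset (Fin n)) (r : Fin T) : Prop :=
  τ r ≤ #(S ∩ U r) ∧ z r (ω r) S

instance (τ : ℕ → ℕ) (z : ℕ → H → Finset (Fin n) → Bool) (ω : Fin T → H)
    (U : Fin T → Finset (Fin n)) (S : Finset (Fin n)) : DecidablePred (IsPicked τ z ω U S) :=
  fun r => inferInstanceAs (Decidable (τ r ≤ #(S ∩ U r) ∧ z r (ω r) S))

/-- The contribution of a set to the counters. -/
def contribution (τ : ℕ → ℕ) (z : ℕ → H → Finset (Fin n) → Bool) (k : Knowledge n J T L B Q H)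
    (S : Finset (Fin n)) : Counters n J T L B Q :=
  (fun j r x => if x ∈ S ∧ IsPicked τ z (k.1.1 j) (k.2.1 j) S r then 1 else 0,
    fun j l b => if (∃ r, IsPicked τ z (k.1.1 j) (k.2.1 j) S r) ∧ linearHash (k.1.2 l) S = b
      then 1 else 0)

/-- The knowledge after a pass. -/
def update [NeZero T] (k : Knowledge n J T L B Q H) (v : Counters n J T L B Q) :
    Knowledge n J T L B Q H :=
  (k.1, fun j i => if (i : ℕ) = 0 then univ else
    {x ∈ k.2.1 j (Fin.ofNat T (i - 1)) | v.1 j (Fin.ofNat T (i - 1)) x = 0}, v.2)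

/-- The largest number of nonzero buckets of a hash table of a copy. -/
def tableSize [NeZero B] (k : Knowledge n J T L B Q H) (j : Fin J) : ℕ :=
  univ.sup fun l => #{b | k.2.2 j l b ≠ 0}

/-- The copy with the smallest hash tables. -/
noncomputable def bestCopy [NeZero J] [NeZero B] (k : Knowledge n J T L B Q H) : Fin J :=
  Classical.choose (Finite.exists_min (tableSize k))

/-- The sets that are chosen at the end. -/
noncomputable def output [NeZero J] [NeZero B] (τ : ℕ → ℕ) (z : ℕ → H → Finset (Fin n) → Bool)
    (k : Knowledge n J T L B Q H) (S : Finset (Fin n)) : Bool :=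
  decide ((∃ r, IsPicked τ z (k.1.1 (bestCopy k)) (k.2.1 (bestCopy k)) S r) ∧
    ∀ l, k.2.2 (bestCopy k) l (linearHash (k.1.2 l) S) ≠ 0)

/-- The knowledge at the beginning. -/
def initial (ω : Seeds n J T L B H) : Knowledge n J T L B Q H := (ω, fun _ _ => ∅, fun _ _ _ => 0)

/-- The cover computed by one copy. -/
def copyCover [NeZero T] (τ : ℕ → ℕ) (z : ℕ → H → Finset (Fin n) → Bool)
    (𝒮 : Finset (Finset (Fin n))) (ω : Fin T → H) : Finset (Finset (Fin n)) :=
  coverAfter 𝒮 τ (fun r => z r (ω (Fin.ofNat T r))) T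

variable {τ : ℕ → ℕ} {z : ℕ → H → Finset (Fin n) → Bool} {f : Finset (Fin n) → ℤ}
  {𝒮 : Finset (Finset (Fin n))}

theorem sum_contribution_fst_eq_zero_iff (hf : ∀ S, 0 ≤ f S) (hQ : ∑ S, f S < Q)
    (h𝒮 : ∀ S, S ∈ 𝒮 ↔ 0 < f S) (k : Knowledge n J T L B Q H) (j : Fin J) (r : Fin T)
    (x : Fin n) : (∑ S, f S • contribution τ z k S).1 j r x = 0 ↔
      ∀ S ∈ 𝒮, ¬ (x ∈ S ∧ IsPicked τ z (k.1.1 j) (k.2.1 j) S r) := by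
  have := sum_zsmul_ite_eq_zero_iff hf hQ
    (fun S => x ∈ S ∧ IsPicked τ z (k.1.1 j) (k.2.1 j) S r)
  simp only [Prod.fst_sum, Finset.sum_apply, Prod.smul_fst, Pi.smul_apply, contribution, h𝒮]
  exact this

theorem sum_contribution_snd_ne_zero_iff (hf : ∀ S, 0 ≤ f S) (hQ : ∑ S, f S < Q)
    (h𝒮 : ∀ S, S ∈ 𝒮 ↔ 0 < f S) (k : Knowledge n J T L B Q H) (j : Fin J) (l : Fin L)
    (b : ZMod B) : (∑ S, f S • contribution τ z k S).2 j l b ≠ 0 ↔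
      ∃ S ∈ 𝒮, (∃ r, IsPicked τ z (k.1.1 j) (k.2.1 j) S r) ∧ linearHash (k.1.2 l) S = b := by
  have := sum_zsmul_ite_eq_zero_iff hf hQ
    (fun S => (∃ r, IsPicked τ z (k.1.1 j) (k.2.1 j) S r) ∧ linearHash (k.1.2 l) S = b)
  simp only [Prod.snd_sum, Finset.sum_apply, Prod.smul_snd, Pi.smul_apply, contribution]
  rw [ne_eq, this]
  push Not
  simp only [h𝒮]

variable [NeZero T]

theorem iterate_update_fst (ω : Seeds n J T L B H) (q : ℕ) :
    ((fun k : Knowledge n J T L B Q H =>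
      update k (∑ S, f S • contribution τ z k S))^[q] (initial ω)).1 = ω := by
  induction q with
  | zero => rfl
  | succ q ih => rw [Function.iterate_succ_apply']; exact ih

/-- Each pass makes one more round correct: one pass replaces the initial `∅` of round `0` by
`univ`, and correct data for round `s` give the correct uncovered set of round `s + 1` in the next
pass. Entries of later rounds may be meaningless meanwhile. -/
theorem iterate_update_uncovered (hf : ∀ S, 0 ≤ f S) (hQ : ∑ S, f S < Q)
    (h𝒮 : ∀ S, S ∈ 𝒮 ↔ 0 < f S) (ω : Seeds n J T L B H) (j : Fin J) (q : ℕ) (i : Fin T)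
    (hi : (i : ℕ) < q) :
    ((fun k : Knowledge n J T L B Q H =>
      update k (∑ S, f S • contribution τ z k S))^[q] (initial ω)).2.1 j i =
      uncovered 𝒮 τ (fun r => z r (ω.1 j (Fin.ofNat T r))) i := by
  induction q generalizing i with
  | zero => omega
  | succ q ih =>
    rw [Function.iterate_succ_apply']
    set k := (fun k : Knowledge n J T L B Q H =>
      update k (∑ S, f S • contribution τ z k S))^[q] (initial ω) with hk
    have hk1 : k.1 = ω := iterate_update_fst ω q
    rcases Nat.eq_zero_or_pos (i : ℕ) with h0 | h0
    · rw [h0]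
      exact if_pos h0
    · obtain ⟨s, hs⟩ : ∃ s, (i : ℕ) = s + 1 := ⟨i - 1, by omega⟩
      have hsT : s < T := by omega
      have hval : (Fin.ofNat T s : ℕ) = s := Nat.mod_eq_of_lt hsT
      have ih' := ih (Fin.ofNat T s) (by rw [hval]; omega)
      rw [hval] at ih'
      simp only [update, hs, Nat.succ_ne_zero, if_false, Nat.add_sub_cancel, ih']
      rw [uncovered, leftover]
      ext x
      simp only [mem_filter, and_congr_right_iff]
      intro _
      rw [sum_contribution_fst_eq_zero_iff hf hQ h𝒮]
      simp only [IsPicked, ih', hk1, hval, pickedSets, eligibleSets, mem_filter]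
      constructor
      · rintro h S ⟨⟨h1, h2⟩, h3⟩ hx
        exact h S h1 ⟨hx, h2, h3⟩
      · rintro h S h1 ⟨hx, h2, h3⟩
        exact h S ⟨⟨h1, h2⟩, h3⟩ hx

/-- Seeds and uncovered sets thus encode the cover within `𝒮`. A set outside `𝒮` can pass the same
test, which is why the output also consults the hash tables. -/
theorem exists_isPicked_iterate_iff (hf : ∀ S, 0 ≤ f S) (hQ : ∑ S, f S < Q)
    (h𝒮 : ∀ S, S ∈ 𝒮 ↔ 0 < f S) (ω : Seeds n J T L B H) (j : Fin J) {q : ℕ} (hq : T ≤ q)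
    {S : Finset (Fin n)} (hS : S ∈ 𝒮) :
    (∃ r, IsPicked τ z (ω.1 j) (((fun k : Knowledge n J T L B Q H =>
      update k (∑ S, f S • contribution τ z k S))^[q] (initial ω)).2.1 j) S r) ↔
      S ∈ copyCover τ z 𝒮 (ω.1 j) := by
  simp only [copyCover, coverAfter, mem_filter, hS, true_and, IsPicked, mem_range]
  constructor
  · rintro ⟨r, h1, h2⟩
    rw [iterate_update_uncovered hf hQ h𝒮 ω j q r (by omega)] at h1
    refine ⟨r, r.2, h1, ?_⟩
    rwa [show Fin.ofNat T (r : ℕ) = r from Fin.ext (Nat.mod_eq_of_lt r.2)]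
  · rintro ⟨r, hr, h1, h2⟩
    have hval : (Fin.ofNat T r : ℕ) = r := Nat.mod_eq_of_lt hr
    refine ⟨Fin.ofNat T r, ?_, ?_⟩
    · rw [iterate_update_uncovered hf hQ h𝒮 ω j q _ (by omega), hval]
      exact h1
    · rw [hval]
      exact h2

variable [NeZero J] [NeZero B]

/-- If the random choices are good, the output consists of a small cover computed by one of the
copies, and of no set of `𝒳`. -/
theorem output_iterate_of_goodChoices (hf : ∀ S, 0 ≤ f S) (hQ : ∑ S, f S < Q)
    (h𝒮 : ∀ S, S ∈ 𝒮 ↔ 0 < f S) {ω : Seeds n J T L B H} {M : ℝ} {b : ℕ}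
    {𝒳 : Finset (Finset (Fin n))} (hM : 2 * M < b)
    (hgood : GoodChoices (copyCover τ z 𝒮) M b 𝒳 ω) :
    ∃ j, (#(copyCover τ z 𝒮 (ω.1 j)) : ℝ) ≤ 2 * M ∧
      (∀ S ∈ 𝒮, output τ z ((fun k : Knowledge n J T L B Q H =>
        update k (∑ S, f S • contribution τ z k S))^[T + 1] (initial ω)) S = true ↔
          S ∈ copyCover τ z 𝒮 (ω.1 j)) ∧
      ∀ X ∈ 𝒳, output τ z ((fun k : Knowledge n J T L B Q H =>
        update k (∑ S, f S • contribution τ z k S))^[T + 1] (initial ω)) X ≠ true := by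
  classical
  set F := (fun k : Knowledge n J T L B Q H => update k (∑ S, f S • contribution τ z k S)) with hF
  set k := F^[T + 1] (initial ω) with hk
  have hk1 : k.1 = ω := iterate_update_fst ω _
  have htable : ∀ j l c, k.2.2 j l c ≠ 0 ↔
      ∃ S ∈ copyCover τ z 𝒮 (ω.1 j), linearHash (ω.2 l) S = c := by
    intro j l c
    -- The tables kept are those of pass `T + 1`, computed when all `T` rounds are already correct;
    -- this explains the extra pass.
    have h1 : k.2.2 = (∑ S, f S • contribution τ z (F^[T] (initial ω)) S).2 := by
      rw [hk, Function.iterate_succ_apply']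
      rfl
    rw [h1, sum_contribution_snd_ne_zero_iff hf hQ h𝒮]
    have h2 : (F^[T] (initial ω)).1 = ω := iterate_update_fst ω _
    rw [h2]
    constructor
    · rintro ⟨S, hS, h3, h4⟩
      exact ⟨S, (exists_isPicked_iterate_iff hf hQ h𝒮 ω j le_rfl hS).1 h3, h4⟩
    · rintro ⟨S, hS, h4⟩
      have hS' : S ∈ 𝒮 := (mem_filter.1 hS).1
      exact ⟨S, hS', (exists_isPicked_iterate_iff hf hQ h𝒮 ω j le_rfl hS').2 hS, h4⟩
  have hsize : ∀ j, tableSize k j =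
      univ.sup fun l => #((copyCover τ z 𝒮 (ω.1 j)).image (linearHash (ω.2 l))) := by
    intro j
    refine sup_congr rfl fun l _ => ?_
    congr 1
    ext c
    simp only [mem_filter, mem_univ, true_and, htable, mem_image]
  set j := bestCopy k with hj
  have hmin : ∀ j', tableSize k j ≤ tableSize k j' :=
    Classical.choose_spec (Finite.exists_min (tableSize k))
  obtain ⟨⟨j₀, hj₀⟩, hall⟩ := hgood
  -- With `C` for the cover of a copy: `min #C_j b ≤ 2 * tableSize_j ≤ 2 * tableSize_{j₀} ≤ 2 *
  -- #C_{j₀} ≤ 2 * M < b`, so the minimum is not `b`.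
  have hcard : (#(copyCover τ z 𝒮 (ω.1 j)) : ℝ) ≤ 2 * M ∧ #(copyCover τ z 𝒮 (ω.1 j)) ≤ b := by
    obtain ⟨⟨l, hl⟩, -⟩ := hall j
    have h1 : #((copyCover τ z 𝒮 (ω.1 j)).image (linearHash (ω.2 l))) ≤ tableSize k j := by
      rw [hsize]
      exact le_sup (f := fun l => #((copyCover τ z 𝒮 (ω.1 j)).image (linearHash (ω.2 l))))
        (mem_univ l)
    have h2 : tableSize k j₀ ≤ #(copyCover τ z 𝒮 (ω.1 j₀)) := by
      rw [hsize]
      exact Finset.sup_le fun l _ => card_image_le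
    have h3 : min #(copyCover τ z 𝒮 (ω.1 j)) b ≤ 2 * #(copyCover τ z 𝒮 (ω.1 j₀)) := by
      have := hmin j₀
      omega
    have h4 : ((min #(copyCover τ z 𝒮 (ω.1 j)) b : ℕ) : ℝ) ≤ 2 * M := by
      have : ((min #(copyCover τ z 𝒮 (ω.1 j)) b : ℕ) : ℝ) ≤ 2 * #(copyCover τ z 𝒮 (ω.1 j₀)) := by
        exact_mod_cast h3
      linarith
    rcases le_total #(copyCover τ z 𝒮 (ω.1 j)) b with h | h
    · rw [min_eq_left h] at h4
      exact ⟨h4, h⟩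
    · rw [min_eq_right h] at h4
      linarith
  refine ⟨j, hcard.1, fun S hS => ?_, fun X hX => ?_⟩
  · simp only [output, decide_eq_true_eq, ← hj, hk1]
    rw [exists_isPicked_iterate_iff hf hQ h𝒮 ω j (by omega) hS]
    exact ⟨fun h => h.1, fun h => ⟨h, fun l => (htable j l _).2 ⟨S, h, rfl⟩⟩⟩
  · simp only [output, ne_eq, decide_eq_true_eq, ← hj, hk1]
    rintro ⟨-, h⟩
    obtain ⟨l, hl⟩ := (hall j).2 hcard.2 X hX
    obtain ⟨S, hS, hSX⟩ := (htable j l _).1 (h l)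
    exact hl S hS hSX

end CoverSketch

/-! ### Choice of parameters and conclusion -/

theorem ofReal_le_toOuterMeasure_uniformOfFintype {Ω : Type*} [Fintype Ω] [Nonempty Ω]
    (P : Ω → Prop) [DecidablePred P] {k : ℕ} (hk : 0 < k)
    (h : #{ω | ¬ P ω} * k ≤ Fintype.card Ω) :
    ENNReal.ofReal (1 - 1 / (k : ℝ)) ≤ (PMF.uniformOfFintype Ω).toOuterMeasure {ω | P ω} := by
  classical
  have hΩ : (0 : ℝ) < Fintype.card Ω := by exact_mod_cast Fintype.card_pos
  have hk' : (0 : ℝ) < k := by exact_mod_cast hk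
  have h1 := card_filter_add_card_filter_not (s := (univ : Finset Ω)) P
  rw [card_univ] at h1
  have h2 : (#{ω | P ω} : ℝ) + #{ω | ¬ P ω} = Fintype.card Ω := by exact_mod_cast h1
  have h3 : (#{ω | ¬ P ω} : ℝ) * k ≤ Fintype.card Ω := by exact_mod_cast h
  have h4 : 1 - 1 / (k : ℝ) ≤ #{ω | P ω} / Fintype.card Ω := by
    rw [le_div_iff₀ hΩ, sub_mul, one_mul, one_div_mul_eq_div]
    have : (#{ω | ¬ P ω} : ℝ) ≤ Fintype.card Ω / k := by rwa [le_div_iff₀ hk']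
    linarith
  rw [PMF.toOuterMeasure_uniformOfFintype_apply]
  refine (ENNReal.ofReal_le_ofReal h4).trans ?_
  rw [ENNReal.ofReal_div_of_pos hΩ, ENNReal.ofReal_natCast, ENNReal.ofReal_natCast]
  gcongr
  rw [← Fintype.card_subtype]
  exact le_of_eq (Fintype.card_congr (Equiv.refl _))

/-- A family of sets that covers contains a cover with at most as many sets as elements. -/
theorem exists_setCover_card_le {n : ℕ} {𝒮 : Finset (Finset (Fin n))} (h : IsSetCover 𝒮 𝒮) :
    ∃ 𝒟, IsSetCover 𝒮 𝒟 ∧ #𝒟 ≤ n := by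
  choose g hg hx using h.2
  refine ⟨univ.image g, ⟨?_, fun x => ⟨g x, mem_image_of_mem g (mem_univ x), hx x⟩⟩, ?_⟩
  · intro S hS
    obtain ⟨x, -, rfl⟩ := mem_image.1 hS
    exact hg x
  · exact card_image_le.trans (by simp)

theorem exists_min_setCover {n : ℕ} {𝒮 : Finset (Finset (Fin n))} (h : IsSetCover 𝒮 𝒮) :
    ∃ 𝒟, IsSetCover 𝒮 𝒟 ∧ #𝒟 ≤ n ∧ ∀ 𝒟', IsSetCover 𝒮 𝒟' → #𝒟 ≤ #𝒟' := by
  classical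
  obtain ⟨𝒟, h𝒟, hmin⟩ := exists_min_image (univ.filter fun 𝒟 => IsSetCover 𝒮 𝒟) card
    ⟨𝒮, by simpa using h⟩
  simp only [mem_filter, mem_univ, true_and] at h𝒟 hmin
  obtain ⟨𝒟₀, h₀, hn⟩ := exists_setCover_card_le h
  exact ⟨𝒟, h𝒟, (hmin 𝒟₀ h₀).trans hn, hmin⟩

/-- The thresholds are halved after every `R + 1` rounds. -/
def phaseThreshold (l R : ℕ) (r : ℕ) : ℕ := 2 ^ (l - r / (R + 1))

/-- In a phase of `R + 1` rounds the sampling probability is doubled in every round, until all sets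
are sampled in the last one. -/
def phaseSampling {n : ℕ} (R : ℕ) (r : ℕ) (h : HashSeed (Fin n) (2 ^ R)) (S : Finset (Fin n)) :
    Bool :=
  decide ((linearHash h S).val < 2 ^ (r % (R + 1)))

theorem phaseSampling_last {n R r : ℕ} (hr : r % (R + 1) = R) (h : HashSeed (Fin n) (2 ^ R))
    (S : Finset (Fin n)) : phaseSampling R r h S = true := by
  simp only [phaseSampling, hr, decide_eq_true_eq]
  exact ZMod.val_lt _

theorem isSamplingSchedule_phase {n m l R : ℕ} (hn : n ≤ 2 * 2 ^ l) (hm : m ≤ 2 ^ R) :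
    IsSamplingSchedule m (phaseThreshold l R)
      (fun r => ((2 ^ (r % (R + 1)) : ℕ) : ℝ) / ((2 ^ R : ℕ) : ℝ))
      (phaseSampling (n := n) R) := by
  have hp1 : ∀ r, r % (R + 1) = 0 →
      ((2 ^ (r % (R + 1)) : ℕ) : ℝ) / ((2 ^ R : ℕ) : ℝ) * m ≤ 1 := by
    intro r hr
    rw [hr, pow_zero, Nat.cast_one, one_div_mul_eq_div, div_le_one (by positivity)]
    exact_mod_cast hm
  refine ⟨fun r => ?_, fun r => by positivity, fun r => by simp [phaseThreshold],
    ⟨by simpa [phaseThreshold] using hn, hp1 0 (by simp)⟩, fun r => ?_⟩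
  · apply isPairwiseSampling_linearHash
    have : r % (R + 1) < R + 1 := Nat.mod_lt r (Nat.succ_pos R)
    exact Nat.pow_le_pow_right (by norm_num) (by omega)
  · have hdm := Nat.div_add_mod r (R + 1)
    have hlt := Nat.mod_lt r (Nat.succ_pos R)
    set a := r / (R + 1) with ha
    set i := r % (R + 1) with hi
    by_cases hiR : i = R
    · right
      have hr1 : r + 1 = (R + 1) * (a + 1) := by rw [mul_add, mul_one]; omega
      refine ⟨fun h S => phaseSampling_last hiR h S, ?_, ?_⟩
      · simp only [phaseThreshold]
        rw [hr1, Nat.mul_div_cancel_left _ (Nat.succ_pos R), ← pow_succ', ← ha]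
        -- The truncated subtraction keeps the threshold at `1` after phase `l`, so the inequality
        -- persists for all `r`.
        exact Nat.pow_le_pow_right (by norm_num) (by omega)
      · apply hp1
        rw [hr1]
        simp
    · left
      have hr1 : r + 1 = (i + 1) + (R + 1) * a := by omega
      have hlt' : i + 1 < R + 1 := by omega
      constructor
      · simp only [phaseThreshold]
        rw [hr1, Nat.add_mul_div_left _ _ (Nat.succ_pos R), Nat.div_eq_of_lt hlt', zero_add]
      · rw [hr1, Nat.add_mul_mod_self_left, Nat.mod_eq_of_lt hlt', pow_succ]
        push_cast
        rw [mul_div_right_comm, mul_comm]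

theorem sum_setMultiplicity_lt {n m d : ℕ} (hn : 2 ≤ n) (hm : 2 ≤ m) {F : List (SetUpdate n)}
    (hF : ∀ S, 0 ≤ setMultiplicity F S) (hcard : #(finalSets F) ≤ m)
    (hmult : ∀ S, setMultiplicity F S ≤ ((n * m) ^ d : ℕ)) :
    ∑ S, setMultiplicity F S < ((2 ^ ((d + 1) * Nat.clog 2 (n * m)) : ℕ) : ℤ) := by
  have h1 : ∑ S, setMultiplicity F S = ∑ S ∈ finalSets F, setMultiplicity F S := by
    symm
    apply sum_subset (subset_univ _)
    intro S _ hS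
    simp only [finalSets, mem_filter, mem_univ, true_and, not_lt] at hS
    exact le_antisymm hS (hF S)
  have h2 : ∑ S ∈ finalSets F, setMultiplicity F S ≤ ((m * (n * m) ^ d : ℕ) : ℤ) := by
    refine (sum_le_card_nsmul _ _ _ fun S _ => hmult S).trans ?_
    rw [nsmul_eq_mul]
    push_cast
    gcongr
  have h3 : m * (n * m) ^ d < 2 ^ ((d + 1) * Nat.clog 2 (n * m)) := by
    calc m * (n * m) ^ d < (n * m) * (n * m) ^ d := by
          apply Nat.mul_lt_mul_of_pos_right _ (by positivity)
          nlinarith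
      _ = (n * m) ^ (d + 1) := by ring
      _ ≤ (2 ^ Nat.clog 2 (n * m)) ^ (d + 1) :=
          Nat.pow_le_pow_left (Nat.le_pow_clog (by norm_num) _) _
      _ = 2 ^ ((d + 1) * Nat.clog 2 (n * m)) := by rw [← pow_mul, mul_comm]
  rw [h1]
  exact lt_of_le_of_lt h2 (by exact_mod_cast h3)

-- The exponents count, in order, bits for sampling seeds, table seeds, uncovered sets, tables and
-- element counters. The tables occur twice: as remembered and as running values.
set_option synthInstance.maxHeartbeats 200000 in
set_option synthInstance.maxSize 1000 in
theorem card_knowledge_mul_card_counters_le {n J T L B q R β : ℕ} [NeZero B] (hB : B ≤ 2 ^ β) :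
    Fintype.card (CoverSketch.Knowledge n J T L B (2 ^ q) (HashSeed (Fin n) (2 ^ R))) *
      Fintype.card (CoverSketch.Counters n J T L B (2 ^ q)) ≤
    2 ^ (R * (n + 1) * T * J + β * (n + 1) * L + n * T * J + 2 * (q * B * L * J) +
      q * n * T * J) := by
  simp only [Fintype.card_prod, Fintype.card_fun, Fintype.card_option, Fintype.card_fin, ZMod.card,
    Fintype.card_finset, ← pow_mul]
  have h : B ^ ((n + 1) * L) ≤ 2 ^ (β * (n + 1) * L) := by
    rw [mul_assoc, pow_mul 2]
    exact Nat.pow_le_pow_left hB _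
  calc _ ≤ 2 ^ (R * (n + 1) * T * J) * 2 ^ (β * (n + 1) * L) *
      (2 ^ (n * T * J) * 2 ^ (q * B * L * J)) * (2 ^ (q * n * T * J) * 2 ^ (q * B * L * J)) := by
        gcongr
    _ = _ := by
        rw [← pow_add, ← pow_add, ← pow_add, ← pow_add, ← pow_add]
        congr 1
        ring

theorem clog_le_four_mul_log {n m : ℕ} (hn : 2 ≤ n) (hm : 2 ≤ m) :
    (Nat.clog 2 (n * m) : ℝ) ≤ 4 * (Real.log m + Real.log n) := by
  have hnm : 4 ≤ n * m := by nlinarith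
  have h1 : 2 ^ (Nat.clog 2 (n * m)).pred < n * m := Nat.pow_pred_clog_lt_self (by norm_num) (by omega)
  have hl2 := Real.log_two_gt_d9
  have h2 : ((Nat.clog 2 (n * m)).pred : ℝ) * Real.log 2 ≤ Real.log ((n : ℝ) * m) := by
    rw [← Real.log_pow]
    apply Real.log_le_log (by positivity)
    exact_mod_cast h1.le
  have hn0 : (n : ℝ) ≠ 0 := by positivity
  have hm0 : (m : ℝ) ≠ 0 := by positivity
  rw [Real.log_mul hn0 hm0] at h2
  have h3 : Real.log 2 ≤ Real.log n := Real.log_le_log (by norm_num) (by exact_mod_cast hn)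
  have h4 : Real.log 2 ≤ Real.log m := Real.log_le_log (by norm_num) (by exact_mod_cast hm)
  have h5 : (Nat.clog 2 (n * m) : ℝ) ≤ (Nat.clog 2 (n * m)).pred + 1 := by
    have : Nat.clog 2 (n * m) ≤ (Nat.clog 2 (n * m)).pred + 1 := by
      rw [Nat.pred_eq_sub_one]; omega
    exact_mod_cast this
  have h6 : (0 : ℝ) ≤ ((Nat.clog 2 (n * m)).pred : ℝ) := by positivity
  nlinarith

theorem phases_mul_rounds_le {n m : ℕ} (hn : 2 ≤ n) (hm : 2 ≤ m) :
    (((Nat.log 2 n + 1) * (Nat.clog 2 m + 1) + 1 : ℕ) : ℝ) ≤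
      100 * (Real.log m * Real.log n) := by
  have hl2 := Real.log_two_gt_d9
  have h3 : Real.log 2 ≤ Real.log n := Real.log_le_log (by norm_num) (by exact_mod_cast hn)
  have h4 : Real.log 2 ≤ Real.log m := Real.log_le_log (by norm_num) (by exact_mod_cast hm)
  have h1 : (Nat.log 2 n : ℝ) * Real.log 2 ≤ Real.log n := by
    rw [← Real.log_pow]
    apply Real.log_le_log (by positivity)
    exact_mod_cast Nat.pow_log_le_self 2 (by omega)
  have h2 : ((Nat.clog 2 m).pred : ℝ) * Real.log 2 ≤ Real.log m := by
    rw [← Real.log_pow]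
    apply Real.log_le_log (by positivity)
    exact_mod_cast (Nat.pow_pred_clog_lt_self (b := 2) (by norm_num) (by omega)).le
  have h5 : (Nat.clog 2 m : ℝ) ≤ (Nat.clog 2 m).pred + 1 := by
    have : Nat.clog 2 m ≤ (Nat.clog 2 m).pred + 1 := by rw [Nat.pred_eq_sub_one]; omega
    exact_mod_cast this
  have h6 : (Nat.log 2 n : ℝ) + 1 ≤ 4 * Real.log n := by
    have : (0 : ℝ) ≤ Nat.log 2 n := by positivity
    nlinarith
  have h7 : (Nat.clog 2 m : ℝ) + 1 ≤ 6 * Real.log m := by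
    have : (0 : ℝ) ≤ ((Nat.clog 2 m).pred : ℝ) := by positivity
    nlinarith
  have h8 : ((Nat.log 2 n : ℝ) + 1) * ((Nat.clog 2 m : ℝ) + 1) ≤
      (4 * Real.log n) * (6 * Real.log m) := by gcongr
  -- The lower bound lets the product of logarithms absorb the extra pass.
  have h9 : 0.6 * 0.6 ≤ Real.log m * Real.log n := by gcongr <;> linarith
  push_cast
  nlinarith

/-- Here `l` stands for `Nat.clog 2 (n * m)`. The fourth power comes from the sampling seeds, the
tables and the element counters. -/
theorem space_le {n c d R T J L q l : ℕ} (hn : 1 ≤ n) (hl : 1 ≤ l) (hR : R ≤ l) (hT : T ≤ 4 * l ^ 2)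
    (hJ : J = (c + 1) * l) (hL : L ≤ (2 * c + d + 3) * l) (hq : q = (d + 1) * l) :
    R * (n + 1) * T * J + (8 + 2 * l) * (n + 1) * L + n * T * J + 2 * (q * (256 * n * l) * L * J) +
      q * n * T * J ≤
    (12 * (c + 1) + 20 * (2 * c + d + 3) + 512 * ((d + 1) * (2 * c + d + 3) * (c + 1)) +
      4 * ((d + 1) * (c + 1))) * n * l ^ 4 := by
  have hn1 : n + 1 ≤ 2 * n := by omega
  have hl8 : 8 + 2 * l ≤ 10 * l := by omega
  have h2 : l ^ 2 ≤ l ^ 4 := Nat.pow_le_pow_right hl (by norm_num)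
  have h3 : l ^ 3 ≤ l ^ 4 := Nat.pow_le_pow_right hl (by norm_num)
  subst hJ hq
  calc _ ≤ l * (2 * n) * (4 * l ^ 2) * ((c + 1) * l) +
        (10 * l) * (2 * n) * ((2 * c + d + 3) * l) + n * (4 * l ^ 2) * ((c + 1) * l) +
        2 * ((d + 1) * l * (256 * n * l) * ((2 * c + d + 3) * l) * ((c + 1) * l)) +
        (d + 1) * l * n * (4 * l ^ 2) * ((c + 1) * l) := by gcongr
    _ = 8 * (c + 1) * n * l ^ 4 + 20 * (2 * c + d + 3) * n * l ^ 2 + 4 * (c + 1) * n * l ^ 3 +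
        512 * ((d + 1) * (2 * c + d + 3) * (c + 1)) * n * l ^ 4 +
        4 * ((d + 1) * (c + 1)) * n * l ^ 4 := by ring
    _ ≤ 8 * (c + 1) * n * l ^ 4 + 20 * (2 * c + d + 3) * n * l ^ 4 + 4 * (c + 1) * n * l ^ 4 +
        512 * ((d + 1) * (2 * c + d + 3) * (c + 1)) * n * l ^ 4 +
        4 * ((d + 1) * (c + 1)) * n * l ^ 4 := by gcongr
    _ = _ := by ring

/-- A good run of the sketch returns an approximate set cover without deleted sets. -/
theorem isApproxSetCover_output {n J L B Q l R : ℕ} [NeZero J] [NeZero B]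
    [NeZero ((l + 1) * (R + 1))] {F : List (SetUpdate n)} (hn : 2 ≤ n)
    (hF : ∀ S, 0 ≤ setMultiplicity F S) (hQ : ∑ S, setMultiplicity F S < Q)
    {b : ℕ} {𝒟 : Finset (Finset (Fin n))} (h𝒟 : IsSetCover (finalSets F) 𝒟)
    (hmin : ∀ 𝒟', IsSetCover (finalSets F) 𝒟' → #𝒟 ≤ #𝒟')
    (hM : 2 * (2 * (8 * (1 + Real.log n) * #𝒟)) < b)
    {𝒳 : Finset (Finset (Fin n))}
    {ω : CoverSketch.Seeds n J ((l + 1) * (R + 1)) L B (HashSeed (Fin n) (2 ^ R))}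
    (hgood : GoodChoices (CoverSketch.copyCover (phaseThreshold l R) (phaseSampling R)
      (finalSets F)) (2 * (8 * (1 + Real.log n) * #𝒟)) b 𝒳 ω) :
    IsApproxSetCover (100 * Real.log n) (finalSets F) ((finalSets F).filter fun S =>
      CoverSketch.output (phaseThreshold l R) (phaseSampling R)
        ((fun k : CoverSketch.Knowledge n J ((l + 1) * (R + 1)) L B Q (HashSeed (Fin n) (2 ^ R)) =>
          CoverSketch.update k (∑ S, setMultiplicity F S • CoverSketch.contribution
            (phaseThreshold l R) (phaseSampling R) k S))^[(l + 1) * (R + 1) + 1]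
          (CoverSketch.initial ω)) S = true) ∧
    ∀ X ∈ 𝒳, CoverSketch.output (phaseThreshold l R) (phaseSampling R)
        ((fun k : CoverSketch.Knowledge n J ((l + 1) * (R + 1)) L B Q (HashSeed (Fin n) (2 ^ R)) =>
          CoverSketch.update k (∑ S, setMultiplicity F S • CoverSketch.contribution
            (phaseThreshold l R) (phaseSampling R) k S))^[(l + 1) * (R + 1) + 1]
          (CoverSketch.initial ω)) X ≠ true := by
  obtain ⟨j, h1, h2, h3⟩ := CoverSketch.output_iterate_of_goodChoices (Q := Q) hF hQ
    (𝒮 := finalSets F) (fun S => by simp [finalSets]) hM hgood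
  refine ⟨?_, h3⟩
  rw [filter_congr h2]
  have hsub : CoverSketch.copyCover (phaseThreshold l R) (phaseSampling R) (finalSets F) (ω.1 j) ⊆
      finalSets F := filter_subset _ _
  rw [filter_mem_eq_inter, inter_eq_right.2 hsub]
  refine ⟨⟨hsub, fun x => ?_⟩, fun 𝒟' h𝒟' => ?_⟩
  · apply exists_mem_coverAfter
    -- The last round is round `R` of phase `l`: threshold `2 ^ 0 = 1` and full sampling, so
    -- everything gets covered.
    have hT : (l + 1) * (R + 1) = (R + (R + 1) * l) + 1 := by ring
    have hlast : ∀ y : ℕ → Finset (Fin n) → Bool,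
        (∀ S, y (R + (R + 1) * l) S) → uncovered (finalSets F) (phaseThreshold l R) y
          ((l + 1) * (R + 1)) = ∅ := by
      intro y hy
      rw [hT]
      refine uncovered_eq_empty ?_ hy fun x => (h𝒟.2 x).imp fun S hS => ⟨h𝒟.1 hS.1, hS.2⟩
      rw [phaseThreshold, Nat.add_mul_div_left _ _ (Nat.succ_pos R),
        Nat.div_eq_of_lt (Nat.lt_succ_self R)]
      simp
    rw [hlast]
    · simp
    · intro S
      refine phaseSampling_last ?_ _ S
      rw [Nat.add_mul_mod_self_left, Nat.mod_eq_of_lt (Nat.lt_succ_self R)]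
  · refine h1.trans ?_
    have hl2 := Real.log_two_gt_d9
    have hln : Real.log 2 ≤ Real.log n := Real.log_le_log (by norm_num) (by exact_mod_cast hn)
    have hle : (#𝒟 : ℝ) ≤ #𝒟' := by exact_mod_cast hmin 𝒟' h𝒟'
    have hC : 32 * (1 + Real.log n) ≤ 100 * Real.log n := by linarith
    calc 2 * (2 * (8 * (1 + Real.log n) * #𝒟)) = 32 * (1 + Real.log n) * #𝒟 := by ring
      _ ≤ 100 * Real.log n * #𝒟' := mul_le_mul hC hle (by positivity) (by linarith)

theorem card_not_goodChoices_copyCover_le {n m J L L' B l R b : ℕ} [NeZero B]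
    [NeZero ((l + 1) * (R + 1))] (hn : n ≤ 2 * 2 ^ l) (hm : m ≤ 2 ^ R) (hb : 4 * b ≤ B)
    {𝒮 𝒟 𝒳 : Finset (Finset (Fin n))} (h𝒮 : #𝒮 ≤ m) (h𝒟 : IsSetCover 𝒮 𝒟)
    (h𝒳 : ∀ X ∈ 𝒳, X ∉ 𝒮) (hL : L = J + L') (hJ : J * (1 + #𝒳) ≤ 2 ^ L')
    [DecidablePred fun ω : CoverSketch.Seeds n J ((l + 1) * (R + 1)) L B
      (HashSeed (Fin n) (2 ^ R)) => ¬ GoodChoices (CoverSketch.copyCover (phaseThreshold l R)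
        (phaseSampling R) 𝒮) (2 * (8 * (1 + Real.log n) * #𝒟)) b 𝒳 ω] :
    #{ω : CoverSketch.Seeds n J ((l + 1) * (R + 1)) L B (HashSeed (Fin n) (2 ^ R)) |
      ¬ GoodChoices (CoverSketch.copyCover (phaseThreshold l R) (phaseSampling R) 𝒮)
        (2 * (8 * (1 + Real.log n) * #𝒟)) b 𝒳 ω} * 2 ^ J ≤
      2 * Fintype.card
        (CoverSketch.Seeds n J ((l + 1) * (R + 1)) L B (HashSeed (Fin n) (2 ^ R))) := by
  classical
  have hT : (l + 1) * (R + 1) - 1 = R + (R + 1) * l := by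
    have : (l + 1) * (R + 1) = (R + (R + 1) * l) + 1 := by ring
    omega
  have hE := (isSamplingSchedule_phase hn hm).expect_card_coverAfter_le
    (T := (l + 1) * (R + 1)) h𝒮 h𝒟.1 h𝒟.2
    (by
      rw [hT, phaseThreshold, Nat.add_mul_div_left _ _ (Nat.succ_pos R),
        Nat.div_eq_of_lt (Nat.lt_succ_self R)]
      simp)
    (fun h S => phaseSampling_last
      (by rw [hT, Nat.add_mul_mod_self_left, Nat.mod_eq_of_lt (Nat.lt_succ_self R)]) h S)
  rw [Fintype.card_fin] at hE
  have hM := card_filter_two_mul_lt_mul_two_le (fun _ => by positivity) hE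
  have := card_not_goodChoices_le (J := J) (L := L)
    (𝒞 := CoverSketch.copyCover (phaseThreshold l R) (phaseSampling R) 𝒮) (𝒳 := 𝒳)
    (by convert hM; rfl) (fun ω X hX hXC => h𝒳 X hX (mem_filter.1 hXC).1) hb hL hJ
  convert this

set_option synthInstance.maxHeartbeats 200000 in
set_option synthInstance.maxSize 1000 in
theorem mainTheorem8 :
    ∃ (C : ℝ) (e : ℕ), ∀ c d : ℕ, ∃ K : ℝ, ∀ n m : ℕ, 2 ≤ n → 2 ≤ m →
      ∃ A : StreamingAlgorithm n,
        (A.space : ℝ) ≤ K * (n : ℝ) * (Real.log (m : ℝ) + Real.log (n : ℝ)) ^ e ∧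
        (A.passes : ℝ) ≤ C * (Real.log (m : ℝ) * Real.log (n : ℝ)) ∧
        ∀ F : List (SetUpdate n),
          IsDynamicSetStream F →
          (finalSets F).card ≤ m →
          (∀ S : Finset (Fin n), setMultiplicity F S ≤ ((n * m) ^ d : ℕ)) →
          IsSetCover (finalSets F) (finalSets F) →
          ENNReal.ofReal (1 - 1 / ((n : ℝ) * (m : ℝ)) ^ c) ≤
            (A.run F).toOuterMeasure
              {s | IsApproxSetCover (C * Real.log (n : ℝ)) (finalSets F) (A.solution F s) ∧
                (F.length ≤ (n * m) ^ d → A.ChoosesNoDeletedSet F s)} := by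
  classical
  refine ⟨100, 4, fun c d => ⟨((12 * (c + 1) + 20 * (2 * c + d + 3) +
    512 * ((d + 1) * (2 * c + d + 3) * (c + 1)) + 4 * ((d + 1) * (c + 1)) : ℕ) : ℝ) * 256,
    fun n m hn hm => ?_⟩⟩
  set k := Nat.clog 2 (n * m) with hk
  have hnm : n * m ≤ 2 ^ k := Nat.le_pow_clog (by norm_num) _
  have hk2 : 2 ≤ k := by
    by_contra hcon
    have : 2 ^ k ≤ 2 ^ 1 := Nat.pow_le_pow_right (by norm_num) (by omega)
    nlinarith
  set l := Nat.log 2 n with hl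
  set R := Nat.clog 2 m with hR
  have hnk : n ≤ 2 ^ k := le_trans (Nat.le_mul_of_pos_right n (by omega)) hnm
  have hlk : l ≤ k := by
    apply (Nat.pow_le_pow_iff_right (a := 2) (by norm_num)).1
    exact (Nat.pow_log_le_self 2 (by omega)).trans hnk
  have hRk : R ≤ k := Nat.clog_mono_right 2 (Nat.le_mul_of_pos_left m (by omega))
  -- This gives `2 ^ J ≥ 2 * (n * m) ^ c`, enough for the failure bound `2 / 2 ^ J`. In `L'`, the
  -- summand `J` pays for the copies and `d * k + 1` for `1 + #𝒳`.
  set J := (c + 1) * k with hJ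
  set L' := J + (d * k + 1) with hL'
  -- `B = 4 * b` with `b = 64 * n * k`, which exceeds `32 * (1 + log n) * #𝒟` because `#𝒟 ≤ n` and
  -- `1 + log n < 2 * k`.
  set B := 256 * n * k with hB
  have hJ0 : 0 < J := by positivity
  have : NeZero J := ⟨hJ0.ne'⟩
  have : NeZero B := ⟨by positivity⟩
  have : NeZero ((l + 1) * (R + 1)) := ⟨by positivity⟩
  have hB2 : B ≤ 2 ^ (8 + 2 * k) := by
    rw [pow_add, two_mul, pow_add, hB, mul_assoc]
    have : k ≤ 2 ^ k := Nat.lt_two_pow_self.le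
    gcongr
    norm_num
  obtain ⟨A, hspace, hpasses, hA⟩ := exists_streamingAlgorithm_of_linearSketch (n := n)
    _ ((l + 1) * (R + 1) + 1)
    (card_knowledge_mul_card_counters_le (n := n) (J := J) (T := (l + 1) * (R + 1)) (L := J + L')
      (R := R) (q := (d + 1) * k) hB2)
    CoverSketch.initial
    (CoverSketch.contribution (phaseThreshold l R) (phaseSampling R)) CoverSketch.update
    (CoverSketch.output (phaseThreshold l R) (phaseSampling R))
  refine ⟨A, ?_, ?_, fun F hF hcard hmult hcover => ?_⟩
  · rw [hspace]
    have hT : (l + 1) * (R + 1) ≤ 4 * k ^ 2 := by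
      calc (l + 1) * (R + 1) ≤ (2 * k) * (2 * k) := by gcongr <;> omega
        _ = 4 * k ^ 2 := by ring
    have hLk : J + L' ≤ (2 * c + d + 3) * k := by
      have : (2 * c + d + 3) * k = J + (J + (d * k + k)) := by rw [hJ]; ring
      omega
    have h1 := space_le (n := n) (by omega) (by omega : 1 ≤ k) hRk hT hJ hLk
      (rfl : (d + 1) * k = (d + 1) * k)
    have h2 : (k : ℝ) ^ 4 ≤ 256 * (Real.log m + Real.log n) ^ 4 := by
      calc (k : ℝ) ^ 4 ≤ (4 * (Real.log m + Real.log n)) ^ 4 := by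
            gcongr
            exact clog_le_four_mul_log hn hm
        _ = _ := by ring
    refine (Nat.cast_le.2 h1).trans ?_
    rw [Nat.cast_mul, Nat.cast_mul, Nat.cast_pow]
    refine (mul_le_mul_of_nonneg_left h2 (by positivity)).trans (le_of_eq ?_)
    ring
  · rw [hpasses]
    exact phases_mul_rounds_le hn hm
  · have hF0 : ∀ S, 0 ≤ setMultiplicity F S := hF F (List.prefix_refl F)
    obtain ⟨𝒟, h𝒟, h𝒟n, hmin⟩ := exists_min_setCover hcover
    -- Absent sets are separated only for short streams; taking `∅` otherwise keeps the union bound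
    -- valid for streams of any length.
    set 𝒳 : Finset (Finset (Fin n)) :=
      if F.length ≤ (n * m) ^ d then (F.map Prod.fst).toFinset \ finalSets F else ∅ with h𝒳
    have h𝒳c : #𝒳 ≤ (n * m) ^ d := by
      rw [h𝒳]
      split_ifs with h
      · refine (card_le_card sdiff_subset).trans ((List.toFinset_card_le _).trans ?_)
        rwa [List.length_map]
      · simp
    have h𝒳S : ∀ X ∈ 𝒳, X ∉ finalSets F := by
      intro X hX
      rw [h𝒳] at hX
      split_ifs at hX
      · exact (mem_sdiff.1 hX).2
      · simp at hX
    have hJX : J * (1 + #𝒳) ≤ 2 ^ L' := by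
      rw [hL', pow_add, pow_succ, mul_comm d, pow_mul 2 k d]
      have h1 : J ≤ 2 ^ J := Nat.lt_two_pow_self.le
      have h2 : (n * m) ^ d ≤ (2 ^ k) ^ d := Nat.pow_le_pow_left hnm d
      have h3 : 1 ≤ (2 ^ k) ^ d := Nat.one_le_pow _ _ (by positivity)
      exact Nat.mul_le_mul h1 (by omega)
    have hbad := card_not_goodChoices_copyCover_le (J := J) (L := J + L') (B := B) (l := l) (R := R)
      (b := 64 * n * k) (by rw [← pow_succ']; exact (Nat.lt_pow_succ_log_self (by norm_num) n).le)
      (Nat.le_pow_clog (by norm_num) m) (by rw [hB]; linarith) hcard h𝒟 h𝒳S rfl hJX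
    have hM : 2 * (2 * (8 * (1 + Real.log n) * #𝒟)) < ((64 * n * k : ℕ) : ℝ) := by
      have hlog : Real.log n ≤ k := by
        have h1 : Real.log n ≤ k * Real.log 2 := by
          rw [← Real.log_pow]
          exact Real.log_le_log (by positivity) (by exact_mod_cast hnk)
        have h2 : (k : ℝ) * Real.log 2 ≤ k * 1 := by
          gcongr
          linarith [Real.log_two_lt_d9]
        linarith
      have hk1 : (1 : ℝ) + k < 2 * k := by
        have : (2 : ℝ) ≤ k := by exact_mod_cast hk2
        linarith
      have hn0 : (0 : ℝ) < n := by positivity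
      have hlog0 : 0 ≤ Real.log n := Real.log_natCast_nonneg n
      calc 2 * (2 * (8 * (1 + Real.log n) * #𝒟)) = 32 * (1 + Real.log n) * #𝒟 := by ring
        _ ≤ 32 * (1 + k) * n := by gcongr
        _ < 32 * (2 * k) * n := by gcongr
        _ = _ := by push_cast; ring
    have hprob := ofReal_le_toOuterMeasure_uniformOfFintype
      (GoodChoices (CoverSketch.copyCover (phaseThreshold l R) (phaseSampling R) (finalSets F))
        (2 * (8 * (1 + Real.log n) * #𝒟)) (64 * n * k) 𝒳 :
        CoverSketch.Seeds n J ((l + 1) * (R + 1)) (J + L') B (HashSeed (Fin n) (2 ^ R)) → Prop)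
      (k := (n * m) ^ c) (by positivity) (by
        have h1 : 2 * (n * m) ^ c ≤ 2 ^ J := by
          rw [hJ, add_mul, one_mul, pow_add, mul_comm, mul_comm c, pow_mul]
          have : 2 ^ 1 ≤ 2 ^ k := Nat.pow_le_pow_right (by norm_num) (by omega)
          exact Nat.mul_le_mul (Nat.pow_le_pow_left hnm c) this
        have h2 := (Nat.mul_le_mul_left _ h1).trans hbad
        apply Nat.le_of_mul_le_mul_left _ (by norm_num : 0 < 2)
        rwa [mul_left_comm])
    rw [Nat.cast_pow, Nat.cast_mul] at hprob
    refine hprob.trans (le_trans ?_ (hA F fun sel =>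
      IsApproxSetCover (100 * Real.log n) (finalSets F)
        ((finalSets F).filter fun S => sel S = true) ∧
      (F.length ≤ (n * m) ^ d → ∀ a ∈ F, sel a.1 = true → a.1 ∈ finalSets F)))
    apply MeasureTheory.OuterMeasure.mono
    intro ω hω
    obtain ⟨h1, h2⟩ := isApproxSetCover_output hn hF0
      (sum_setMultiplicity_lt hn hm hF0 hcard hmult) h𝒟 hmin hM hω
    refine ⟨h1, fun hlen a ha hsel => ?_⟩
    by_contra hcon
    refine h2 a.1 ?_ hsel
    rw [h𝒳, if_pos hlen, mem_sdiff, List.mem_toFinset]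
    exact ⟨List.mem_map_of_mem ha, hcon⟩
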